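/- **Definitions.** A realtime *alternating quantum finite automaton* (AQFA) over an alphabet $\Sigma$ has a finite set $S$ of classical states, each either existential or universal, some of them accepting, with an initial state $s_1\in S$; a finite set $Q$ of quantum basis states with an initial one $q_1$; and, for each $s\in S$ and each tape symbol $\sigma\in\Sigma\cup\{\cent\}$ (where $\cent\notin\Sigma$ is the end-marker), a superoperator, i.e. finitely many complex $Q\times Q$ matrices $(E_{s,\sigma,\tau})_\tau$ with $\sum_\tau E_{s,\sigma,\tau}^\dagger E_{s,\sigma,\tau}=I$, together with a next classical state $\delta(s,\sigma,\tau)\in S$ for each outcome $\tau$. An input $w\in\Sigma^*$ is read as $\cent w\cent$, and exactly two steps are spent on each tape symbol. The computation tree has root $(s_1,|q_1\rangle)$; a node $(s,|\psi\rangle)$ at which $\sigma$ is scanned has, for each outcome $\tau$ with $\|E_{s,\sigma,\tau}|\psi\rangle\|^2>0$, the child $\bigl(\delta(s,\sigma,\tau),\,E_{s,\sigma,\tau}|\psi\rangle/\|E_{s,\sigma,\tau}|\psi\rangle\|\bigr)$. A leaf (after the last step) is true iff its classical state is accepting; an inner node with existential (universal) classical state is true iff at least one (every one) of its children is true. The AQFA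 accepts $w$ iff the root is true, and its language is the set of accepted words. An AQFA is given to an algorithm as a finite list of its components, the matrix entries being written in some effective notation for complex numbers, i.e. as elements of an effectively encoded countable set $K$ with a map $K\to\mathbb C$. The emptiness problem asks whether the language of a given (well-formed) AQFA is empty. **Theorem.** The emptiness problem for realtime AQFAs over a unary alphabet is undecidable: for every notation of the amplitudes in which a name of every rational number can be computed from its numerator and denominator (in particular for rational amplitudes), no algorithm halts with the correct answer on every AQFA over a unary alphabet with amplitudes in that notation. Moreover, there is an algorithm that, given a deterministic Turing machine $M$ and an input $w$ of $M$, constructs a realtime AQFA $R_{M,w}$ over a unary alphabet $\{a\}$, with rational amplitudes, whose language is nonempty if and only if $M$ halts on $w$; and if $M$ halts on $w$, then $R_{M,w}$ accepts $a^n$ for all sufficiently large $n$. -/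

import Mathlib

/-! ### Realtime alternating quantum finite automata -/

/-- A (realtime) alternating quantum finite automaton over the input alphabet `α`. The tape symbols
are those of `Option α`, where `none` is the end-marker. In classical state `s` and on symbol `σ`
the superoperator with the operation elements `op s σ τ` is applied; its index `τ` is the outcome,
and `next s σ τ` is the new classical state. -/
structure AQFA (α : Type) where
  /-- the classical states -/
  S : Type
  /-- the basis states of the quantum register -/
  Q : Type
  [finS : Fintype S]
  [finQ : Fintype Q]
  [decQ : DecidableEq Q]
  /-- the existential classical states; all the other classical states are universal -/
  existential : Set S
  /-- the accepting classical states -/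
  accepting : Set S
  /-- the initial classical state -/
  start : S
  /-- the initial quantum (basis) state -/
  qstart : Q
  /-- the outcomes of the superoperator for a classical state and a tape symbol -/
  Outcome : S → Option α → Type
  [finOutcome : ∀ s σ, Fintype (Outcome s σ)]
  /-- the operation elements -/
  op : ∀ s σ, Outcome s σ → Matrix Q Q ℂ
  /-- the operation elements form a superoperator -/
  op_complete : ∀ s σ, ∑ τ, (op s σ τ).conjTranspose * op s σ τ = 1
  /-- the classical transition function -/
  next : ∀ s σ, Outcome s σ → S

namespace AQFA

attribute [instance] AQFA.finS AQFA.finQ AQFA.decQ AQFA.finOutcome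

variable {α : Type}

/-- The unnormalized quantum state after the outcome `τ`. -/
noncomputable def branch (A : AQFA α) (s : A.S) (σ : Option α) (τ : A.Outcome s σ)
    (ψ : EuclideanSpace ℂ A.Q) : EuclideanSpace ℂ A.Q :=
  WithLp.toLp 2 ((A.op s σ τ).mulVec ψ.ofLp)

/-- The probability of observing the outcome `τ` in the pure quantum state `ψ`. -/
noncomputable def prob (A : AQFA α) (s : A.S) (σ : Option α) (τ : A.Outcome s σ)
    (ψ : EuclideanSpace ℂ A.Q) : ℝ :=
  ‖A.branch s σ τ ψ‖ ^ 2

/-- The pure quantum state after the outcome `τ` has been observed. -/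
noncomputable def post (A : AQFA α) (s : A.S) (σ : Option α) (τ : A.Outcome s σ)
    (ψ : EuclideanSpace ℂ A.Q) : EuclideanSpace ℂ A.Q :=
  ((‖A.branch s σ τ ψ‖⁻¹ : ℝ) : ℂ) • A.branch s σ τ ψ

/-- The truth value of the node `(s, ψ)` of the computation tree, when one step is still to be
made on each symbol of the given list. -/
noncomputable def value (A : AQFA α) : List (Option α) → A.S → EuclideanSpace ℂ A.Q → Prop
  | [], s, _ => s ∈ A.accepting
  | σ :: rest, s, ψ =>
      (s ∈ A.existential →
        ∃ τ, 0 < A.prob s σ τ ψ ∧ A.value rest (A.next s σ τ) (A.post s σ τ ψ)) ∧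
      (s ∉ A.existential →
        ∀ τ, 0 < A.prob s σ τ ψ → A.value rest (A.next s σ τ) (A.post s σ τ ψ))

/-- The symbols scanned in the successive steps on the input `w`: the tape is `w` between two
end-markers, and exactly two steps are spent on each tape symbol. -/
def schedule (w : List α) : List (Option α) :=
  (none :: (w.map some ++ [none])).flatMap fun σ => [σ, σ]

/-- `A` accepts `w`: the root of its computation tree on `w` is true. -/
noncomputable def Accepts (A : AQFA α) (w : List α) : Prop :=
  A.value (schedule w) A.start (EuclideanSpace.single A.qstart 1)

/-- The language recognized by `A`. -/
def language (A : AQFA α) : Set (List α) := {w | A.Accepts w}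

end AQFA

/-! ### Finite descriptions of AQFAs over a unary alphabet -/

/-- A finite list of operation elements (each one a square matrix, given as the list of its rows),
each with the classical state that follows the corresponding outcome. -/
abbrev SuperopCode (K : Type) : Type := List (List (List K) × ℕ)

/-- A description of an AQFA over the alphabet `Unit` with amplitudes written as elements of `K`:
* for each classical state `0, 1, …`: whether it is existential, whether it is accepting,
  its superoperator and transitions on the end-marker, and those on the input letter;
* the initial classical state, the number of quantum basis states, the initial basis state. -/
abbrev AQFACode (K : Type) : Type :=
  List (Bool × Bool × SuperopCode K × SuperopCode K) × ℕ × ℕ × ℕ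

namespace AQFACode

variable {K : Type}

/-- The number of classical states. -/
abbrev numS (c : AQFACode K) : ℕ := c.1.length

/-- The initial classical state. -/
abbrev startIdx (c : AQFACode K) : ℕ := c.2.1

/-- The number of quantum basis states. -/
abbrev dim (c : AQFACode K) : ℕ := c.2.2.1

/-- The initial quantum basis state. -/
abbrev qstartIdx (c : AQFACode K) : ℕ := c.2.2.2

/-- The operation elements and transitions for a classical state and a tape symbol. -/
def superop (c : AQFACode K) (s : Fin c.numS) : Option Unit → SuperopCode K
  | none => (c.1.get s).2.2.1
  | some () => (c.1.get s).2.2.2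

/-- The matrix with the given rows; missing entries are zero. -/
def toMatrix (val : K → ℂ) (d : ℕ) (rows : List (List K)) : Matrix (Fin d) (Fin d) ℂ :=
  fun i j => ((rows[(i : ℕ)]?.bind fun row => row[(j : ℕ)]?).map val).getD 0

/-- The description `c` is well formed, the amplitude `k` being read as the number `val k`. -/
structure Valid (val : K → ℂ) (c : AQFACode K) : Prop where
  start_lt : c.startIdx < c.numS
  qstart_lt : c.qstartIdx < c.dim
  next_lt : ∀ s σ (τ : Fin (c.superop s σ).length), ((c.superop s σ).get τ).2 < c.numS
  complete : ∀ s σ, ∑ τ : Fin (c.superop s σ).length,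
    (toMatrix val c.dim ((c.superop s σ).get τ).1).conjTranspose *
      toMatrix val c.dim ((c.superop s σ).get τ).1 = 1

/-- The AQFA described by a well-formed description. -/
def toAQFA (val : K → ℂ) (c : AQFACode K) (h : c.Valid val) : AQFA Unit where
  S := Fin c.numS
  Q := Fin c.dim
  existential := {s | (c.1.get s).1 = true}
  accepting := {s | (c.1.get s).2.1 = true}
  start := ⟨c.startIdx, h.start_lt⟩
  qstart := ⟨c.qstartIdx, h.qstart_lt⟩
  Outcome s σ := Fin (c.superop s σ).length
  op s σ τ := toMatrix val c.dim ((c.superop s σ).get τ).1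
  op_complete := h.complete
  next s σ τ := ⟨((c.superop s σ).get τ).2, h.next_lt s σ τ⟩

end AQFACode

/-- The rational number with numerator `p.1` and denominator `p.2 + 1`. -/
noncomputable def ratVal (p : ℤ × ℕ) : ℂ := (p.1 : ℂ) / ((p.2 : ℂ) + 1)

/-! ### Decidability of a problem whose instances are finite descriptions -/

/-- The problem `P`, with the elements of `α` satisfying `V` as its instances, is decidable: some
algorithm halts on every instance with the correct answer. Nothing is required of the algorithm on
the elements of `α` that are not instances. -/
def DecidableProblem {α : Type} [Primcodable α] {V : α → Prop} (P : ∀ a, V a → Prop) : Prop :=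
  ∃ d : α →. Bool, Partrec d ∧ ∀ a (h : V a), ∃ b ∈ d a, (b = true ↔ P a h)

/-! ### Turing machines -/

/-- A deterministic Turing machine, as a finite list of rules. The rule `((q, a), (q', x))` says
that in state `q`, scanning `a`, the machine enters state `q'` and moves its head
(`x = Sum.inl true`: to the left, `x = Sum.inl false`: to the right) or writes the symbol `b`
(`x = Sum.inr b`). The first matching rule applies, and the machine halts if there is none. -/
abbrev TMCode : Type := List ((ℕ × ℕ) × (ℕ × (Bool ⊕ ℕ)))

namespace TMCode

/-- The Turing machine with the given rules; its initial state is `0`, its blank symbol is `0`. -/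
def toMachine (T : TMCode) : Turing.TM0.Machine ℕ ℕ := fun q a =>
  (T.lookup (q, a)).map fun r =>
    (r.1, match r.2 with
      | Sum.inl true => Turing.TM0.Stmt.move Turing.Dir.left
      | Sum.inl false => Turing.TM0.Stmt.move Turing.Dir.right
      | Sum.inr b => Turing.TM0.Stmt.write b)

/-- The Turing machine halts on the input `w`. -/
def Halts (T : TMCode) (w : List ℕ) : Prop := (Turing.TM0.eval T.toMachine w).Dom

end TMCode

/-! Since every tape symbol gets the same moves, the input serves only as a clock: on `a^n` the
automaton makes `2n + 4` steps, and the language is nonempty iff some clock value of this form is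
good. The truth of a node depends only on which branches vanish, never on how large their amplitudes
are. So, up to scaling, the quantum register can hold an integer vector `(p, x, y)` with `p > 0`,
where `x / p` and `y / p` are the two half-tapes of the Turing machine read as numbers in base `B`;
the control state and the scanned symbol are classical. Pushing and popping a digit are linear in
`(p, x, y)`, once `p` is multiplied by `B`. The popped digit is guessed existentially. A universal
state then either continues or checks the guess: after a wrong guess the popped stack is no longer
an integer multiple of the new `p`. The check subtracts `p` an existentially chosen number of times
and tests for zero; a universal node passes that test exactly when the branch leading to rejection
has amplitude zero. This gives `TMCode.halts_of_value_start` and `TMCode.value_start_of_halts`; the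
latter holds for all large clock values, because acceptance is absorbing and the checks need only
enough time. To make the integer matrices into a superoperator with rational entries and no square
roots, each matrix is accompanied by its products with the quaternion units, whose Gram matrices sum
to a scalar, and copies of a scalar matrix fill up the rest (`sum_gram_superopCode`). The added
outcomes lead to a rejecting sink from existential states and to an accepting sink from universal
ones, so they never affect the truth value; hence `TMCode.value_aqfa_iff`. For undecidability, a
fixed machine simulates a universal partial recursive function
(`TMCode.exists_halts_iff_partrec_dom`), and a decider for emptiness would decide the halting
problem. -/

/-! ### Alternating linear automata over integer vectors -/

/-- A vector of three integers. -/
abbrev Vec3 : Type := ℤ × ℤ × ℤ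

/-- A `3 × 3` integer matrix, as the triple of its rows. -/
abbrev Mat3 : Type := Vec3 × Vec3 × Vec3

namespace Mat3

/-- The inner product of two vectors. -/
def dot (u v : Vec3) : ℤ := u.1 * v.1 + u.2.1 * v.2.1 + u.2.2 * v.2.2

/-- The matrix-vector product. -/
def app (m : Mat3) (v : Vec3) : Vec3 := (dot m.1 v, dot m.2.1 v, dot m.2.2 v)

/-- The identity matrix. -/
def one : Mat3 := ((1, 0, 0), (0, 1, 0), (0, 0, 1))

/-- The map `(p, x, y) ↦ (p, x - p, 0)`. -/
def dec : Mat3 := ((1, 0, 0), (-1, 1, 0), (0, 0, 0))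

/-- The map `(p, x, y) ↦ (x, 0, 0)`. -/
def test : Mat3 := ((0, 1, 0), (0, 0, 0), (0, 0, 0))

/-- The map `(p, x, y) ↦ (p, x + y, 0)`. -/
def merge : Mat3 := ((1, 0, 0), (0, 1, 1), (0, 0, 0))

/-- The map `(p, x, y) ↦ (p, x, y + r * p)`. -/
def load (r : ℕ) : Mat3 := ((1, 0, 0), (0, 1, 0), ((r : ℤ), 0, 1))

/-- Up to a factor `B`, the map that pushes the digit `a` on the stack `x` and pops the digit `b`
from the stack `y`. -/
def pushPop (B a b : ℕ) : Mat3 :=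
  (((B : ℤ), 0, 0), (((B * a : ℕ) : ℤ), ((B * B : ℕ) : ℤ), 0), (-(b : ℤ), 0, 1))

/-- Up to a factor `B`, the map that pushes the digit `a` on the stack `y` and pops the digit `b`
from the stack `x`. -/
def popPush (B a b : ℕ) : Mat3 :=
  (((B : ℤ), 0, 0), (-(b : ℤ), 1, 0), (((B * a : ℕ) : ℤ), 0, ((B * B : ℕ) : ℤ)))

@[simp] theorem app_one (v : Vec3) : app one v = v := by
  simp [app, one, dot]

@[simp] theorem app_dec (p x y : ℤ) : app dec (p, x, y) = (p, x - p, 0) := by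
  simp [app, dec, dot]; ring

@[simp] theorem app_test (p x y : ℤ) : app test (p, x, y) = (x, 0, 0) := by
  simp [app, test, dot]

@[simp] theorem app_merge (p x y : ℤ) : app merge (p, x, y) = (p, x + y, 0) := by
  simp [app, merge, dot]

@[simp] theorem app_load (r : ℕ) (p x y : ℤ) : app (load r) (p, x, y) = (p, x, r * p + y) := by
  simp [app, load, dot]

@[simp] theorem app_pushPop (B a b : ℕ) (p x y : ℤ) :
    app (pushPop B a b) (p, x, y) = (B * p, B * a * p + B * B * x, y - b * p) := by
  simp [app, pushPop, dot]; ring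

@[simp] theorem app_popPush (B a b : ℕ) (p x y : ℤ) :
    app (popPush B a b) (p, x, y) = (B * p, x - b * p, B * a * p + B * B * y) := by
  simp [app, popPush, dot]; ring

end Mat3

/-- An alternating linear automaton: for each state, whether it is existential, and the list of
its possible moves, each one a matrix with the next state. State `1` is accepting. -/
abbrev LinAut : Type := ℕ → Bool × List (Mat3 × ℕ)

namespace LinAut

/-- The truth value of the configuration `(s, v)`, with `k` steps still to be made. Moves that send
the vector to zero are disregarded. -/
def value (A : LinAut) : ℕ → ℕ → Vec3 → Prop
  | 0, s, _ => s = 1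
  | k + 1, s, v =>
      ((A s).1 = true → ∃ m ∈ (A s).2, m.1.app v ≠ 0 ∧ A.value k m.2 (m.1.app v)) ∧
      ((A s).1 = false → ∀ m ∈ (A s).2, m.1.app v ≠ 0 → A.value k m.2 (m.1.app v))

theorem value_succ_of_existential {A : LinAut} {s : ℕ} (h : (A s).1 = true) (k : ℕ) (v : Vec3) :
    A.value (k + 1) s v ↔ ∃ m ∈ (A s).2, m.1.app v ≠ 0 ∧ A.value k m.2 (m.1.app v) := by
  simp [value, h]

theorem value_succ_of_universal {A : LinAut} {s : ℕ} (h : (A s).1 = false) (k : ℕ) (v : Vec3) :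
    A.value (k + 1) s v ↔ ∀ m ∈ (A s).2, m.1.app v ≠ 0 → A.value k m.2 (m.1.app v) := by
  simp [value, h]

end LinAut

/-! ### Simulating a Turing machine -/

namespace TMCode

/-- The state in which the machine is simulated in state `q`, scanning `a`. -/
def simState (q a : ℕ) : ℕ := 5 + 2 * Nat.pair q a

/-- The state in which a guessed digit `a` is verified. -/
def verState (q a : ℕ) : ℕ := 6 + 2 * Nat.pair q a

/-- The moves that perform a rule of the machine. -/
def ruleMoves (B a : ℕ) (r : ℕ × (Bool ⊕ ℕ)) : List (Mat3 × ℕ) :=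
  Sum.casesOn r.2
    (fun d => (List.range B).map fun b =>
      (cond d (Mat3.popPush B a b) (Mat3.pushPop B a b), verState r.1 b))
    (fun b => [(Mat3.one, simState r.1 b)])

/-- The moves in the state `simState q a`. -/
def simMoves (T : TMCode) (B q a : ℕ) : List (Mat3 × ℕ) :=
  Option.casesOn (T.lookup (q, a)) [(Mat3.one, 1)] (ruleMoves B a)

/-- A number exceeding all states and symbols of the machine and of its input. -/
def base (x : TMCode × List ℕ) : ℕ := Encodable.encode x + 1

/-- The number with the given digits, the least significant one first. -/
def digitsVal (B : ℕ) (l : List ℕ) : ℕ := l.foldr (fun d n => d + B * n) 0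

/-- The special states: reject, accept, check for a natural number, check for zero, start. -/
def specials (x : TMCode × List ℕ) : List (Bool × List (Mat3 × ℕ)) :=
  [(true, []), (false, []), (true, [(Mat3.dec, 2), (Mat3.one, 3)]), (false, [(Mat3.test, 0)]),
    (true, [(Mat3.load (digitsVal (base x) x.2.tail), simState 0 x.2.headI)])]

/-- The automaton that simulates a Turing machine on an input. -/
def linAut (x : TMCode × List ℕ) : LinAut := fun i =>
  ((specials x)[i]?).getD <|
    let j := (i - 5) / 2
    cond (decide ((i - 5) % 2 = 0)) (true, simMoves x.1 (base x) j.unpair.1 j.unpair.2)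
      (false, [(Mat3.one, simState j.unpair.1 j.unpair.2), (Mat3.merge, 2)])

variable (x : TMCode × List ℕ)

theorem linAut_simState (q a : ℕ) :
    linAut x (simState q a) = (true, simMoves x.1 (base x) q a) := by
  have h : (specials x)[simState q a]? = none := by
    rw [List.getElem?_eq_none_iff]; simp [specials, simState]
  simp only [linAut, h, Option.getD_none]
  simp [simState]

theorem linAut_verState (q a : ℕ) :
    linAut x (verState q a) = (false, [(Mat3.one, simState q a), (Mat3.merge, 2)]) := by
  have h : (specials x)[verState q a]? = none := by
    rw [List.getElem?_eq_none_iff]; simp [specials, verState]; omega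
  have h1 : (6 + 2 * Nat.pair q a - 5) / 2 = Nat.pair q a := by omega
  have h2 : (6 + 2 * Nat.pair q a - 5) % 2 = 1 := by omega
  simp only [linAut, h, Option.getD_none]
  simp [verState, h1, h2]

theorem value_reject (k : ℕ) (v : Vec3) : ¬ (linAut x).value k 0 v := by
  cases k <;> simp [LinAut.value, linAut, specials]

theorem value_accept (k : ℕ) (v : Vec3) : (linAut x).value k 1 v := by
  cases k <;> simp [LinAut.value, linAut, specials]

/-- The only move leads to rejection and is disregarded exactly when `Mat3.test` kills the vector,
that is, when `n = 0`; the universal state is then vacuously true. At least one step is needed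
because state `3` itself is not accepting. -/
theorem value_zeroCheck_iff (k : ℕ) (p n : ℤ) :
    (linAut x).value k 3 (p, n, 0) ↔ 0 < k ∧ n = 0 := by
  cases k with
  | zero => simp [LinAut.value]
  | succ k =>
    rw [LinAut.value_succ_of_universal (by simp [linAut, specials])]
    simp [linAut, specials, value_reject]

theorem value_natCheck_succ (k : ℕ) {p : ℤ} (hp : 0 < p) (n : ℤ) :
    (linAut x).value (k + 1) 2 (p, n, 0) ↔
      (linAut x).value k 2 (p, n - p, 0) ∨ 0 < k ∧ n = 0 := by
  rw [LinAut.value_succ_of_existential (by simp [linAut, specials])]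
  simp [linAut, specials, hp.ne', ← value_zeroCheck_iff x k p n]

/-- The witness `m` counts the subtractions of `p` made before the switch to the zero test. -/
theorem exists_of_value_natCheck {p : ℤ} (hp : 0 < p) :
    ∀ (k : ℕ) (n : ℤ), (linAut x).value k 2 (p, n, 0) → ∃ m : ℕ, n = m * p
  | 0, n, h => by simp [LinAut.value] at h
  | k + 1, n, h => by
    rcases (value_natCheck_succ x k hp n).1 h with h | h
    · obtain ⟨m, hm⟩ := exists_of_value_natCheck hp k _ h
      exact ⟨m + 1, by push_cast; linarith⟩
    · exact ⟨0, by simp [h.2]⟩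

theorem value_natCheck_of_le {p : ℤ} (hp : 0 < p) :
    ∀ (m k : ℕ), m + 2 ≤ k → (linAut x).value k 2 (p, m * p, 0)
  -- The bound `m + 2` covers `m` subtractions, the switch to the zero test, and the test itself.
  | 0, k + 1, h => (value_natCheck_succ x k hp _).2 (Or.inr ⟨by omega, by simp⟩)
  | m + 1, k + 1, h => by
    refine (value_natCheck_succ x k hp _).2 (Or.inl ?_)
    convert value_natCheck_of_le hp m k (by omega) using 3
    push_cast; ring_nf

theorem value_verState_succ (k q a : ℕ) {p : ℤ} (hp : 0 < p) (m n : ℤ) :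
    (linAut x).value (k + 1) (verState q a) (p, m, n) ↔
      (linAut x).value k (simState q a) (p, m, n) ∧ (linAut x).value k 2 (p, m + n, 0) := by
  rw [LinAut.value_succ_of_universal (by simp [linAut_verState])]
  simp [linAut_verState, hp.ne']

theorem value_simState_succ (k q a : ℕ) (v : Vec3) :
    (linAut x).value (k + 1) (simState q a) v ↔
      ∃ m ∈ simMoves x.1 (base x) q a, m.1.app v ≠ 0 ∧ (linAut x).value k m.2 (m.1.app v) := by
  rw [LinAut.value_succ_of_existential (by simp [linAut_simState]), linAut_simState]

theorem value_simState_zero (q a : ℕ) (v : Vec3) : ¬ (linAut x).value 0 (simState q a) v := by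
  simp only [LinAut.value, simState]; omega

theorem value_verState_zero (q a : ℕ) (v : Vec3) : ¬ (linAut x).value 0 (verState q a) v := by
  simp only [LinAut.value, verState]; omega

/-! #### The tape as a pair of numbers -/

open Turing

/-- `n` is the number whose digits in base `B` are the symbols on the half-tape `L`. -/
def HalfTape (B : ℕ) (L : ListBlank ℕ) (n : ℕ) : Prop := ∀ i, L.nth i = n / B ^ i % B

theorem HalfTape.head {B n : ℕ} {L : ListBlank ℕ} (h : HalfTape B L n) : L.head = n % B := by
  simpa using h 0

theorem HalfTape.tail {B n : ℕ} {L : ListBlank ℕ} (h : HalfTape B L n) :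
    HalfTape B L.tail (n / B) := fun i => by
  rw [← ListBlank.nth_succ, h, pow_succ', Nat.div_div_eq_div_mul]

theorem HalfTape.cons {B n a : ℕ} {L : ListBlank ℕ} (h : HalfTape B L n) (ha : a < B) :
    HalfTape B (L.cons a) (B * n + a) := fun i => by
  cases i with
  | zero => simp [Nat.mod_eq_of_lt ha]
  | succ i =>
    rw [ListBlank.nth_succ, ListBlank.tail_cons, h, pow_succ', ← Nat.div_div_eq_div_mul,
      Nat.mul_add_div (by omega), Nat.div_eq_of_lt ha, add_zero]

theorem halfTape_mk {B : ℕ} (hB : 0 < B) : ∀ l : List ℕ, (∀ a ∈ l, a < B) →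
    HalfTape B (ListBlank.mk l) (digitsVal B l)
  | [], _ => fun i => by simp [digitsVal, ListBlank.nth_mk]
  | a :: l, h => by
    have := (halfTape_mk hB l fun b hb => h b (by simp [hb])).cons (h a (by simp))
    rw [ListBlank.cons_mk] at this
    simpa [digitsVal, add_comm] using this

/-- The tape `t` has the scanned symbol `a`, and `l` and `r` represent its two halves. -/
structure TapeRep (B : ℕ) (t : Tape ℕ) (a l r : ℕ) : Prop where
  head_eq : t.head = a
  head_lt : a < B
  left : HalfTape B t.left l
  right : HalfTape B t.right r

theorem TapeRep.move_right {B a l r : ℕ} {t : Tape ℕ} (h : TapeRep B t a l r) :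
    TapeRep B (t.move Dir.right) (r % B) (B * l + a) (r / B) where
  head_eq := h.right.head
  head_lt := Nat.mod_lt _ (by have := h.head_lt; omega)
  left := by rw [← h.head_eq]; exact h.left.cons (h.head_eq ▸ h.head_lt)
  right := h.right.tail

theorem TapeRep.move_left {B a l r : ℕ} {t : Tape ℕ} (h : TapeRep B t a l r) :
    TapeRep B (t.move Dir.left) (l % B) (l / B) (B * r + a) where
  head_eq := h.left.head
  head_lt := Nat.mod_lt _ (by have := h.head_lt; omega)
  left := h.left.tail
  right := by rw [← h.head_eq]; exact h.right.cons (h.head_eq ▸ h.head_lt)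

theorem TapeRep.write {B a l r b : ℕ} {t : Tape ℕ} (h : TapeRep B t a l r) (hb : b < B) :
    TapeRep B (t.write b) b l r where
  head_eq := rfl
  head_lt := hb
  left := h.left
  right := h.right

/-! #### Bounds -/

/-- The pairing function dominates both of its arguments. Hence the code of the whole instance
bounds every state and symbol in it, which is why `base` can be read off from that code. -/
theorem encode_le_of_mem {α : Type} [Encodable α] {a : α} {l : List α} (h : a ∈ l) :
    Encodable.encode a ≤ Encodable.encode l := by
  induction l with
  | nil => simp at h
  | cons b l ih =>
    rw [Encodable.encode_list_cons]
    rcases List.mem_cons.1 h with rfl | h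
    · exact (Nat.left_le_pair _ _).trans (Nat.le_succ _)
    · exact (ih h).trans ((Nat.right_le_pair _ _).trans (Nat.le_succ _))

theorem mem_of_lookup {α β : Type} [BEq α] [LawfulBEq α] {a : α} {b : β} :
    ∀ {l : List (α × β)}, l.lookup a = some b → (a, b) ∈ l
  | [], h => by simp at h
  | (a', b') :: l, h => by
    rw [List.lookup_cons] at h
    split at h
    · next e => simp_all
    · exact List.mem_cons_of_mem _ (mem_of_lookup h)

theorem encode_prod_eq {α β : Type} [Encodable α] [Encodable β] (a : α × β) :
    Encodable.encode a = Nat.pair (Encodable.encode a.1) (Encodable.encode a.2) := rfl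

theorem base_pos : 0 < base x := Nat.succ_pos _

theorem lt_base_of_mem_input {a : ℕ} (h : a ∈ x.2) : a < base x := by
  have h1 := encode_le_of_mem h
  have h2 := Nat.right_le_pair (Encodable.encode x.1) (Encodable.encode x.2)
  rw [base, encode_prod_eq]
  simp only [Encodable.encode_nat] at *
  omega

theorem encode_rule_lt_base {r : (ℕ × ℕ) × (ℕ × (Bool ⊕ ℕ))} (h : r ∈ x.1) :
    Encodable.encode r.2 < base x := by
  have h1 := encode_le_of_mem h
  have h2 := Nat.left_le_pair (Encodable.encode x.1) (Encodable.encode x.2)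
  have h3 := Nat.right_le_pair (Encodable.encode r.1) (Encodable.encode r.2)
  rw [base, encode_prod_eq x]
  rw [encode_prod_eq r] at h1
  omega

theorem rule_state_lt_base {q a : ℕ} {r : ℕ × (Bool ⊕ ℕ)} (h : x.1.lookup (q, a) = some r) :
    r.1 < base x := by
  have h1 := encode_rule_lt_base x (mem_of_lookup h)
  have h2 := Nat.left_le_pair (Encodable.encode r.1) (Encodable.encode r.2)
  rw [encode_prod_eq] at h1
  simp only [Encodable.encode_nat] at *
  omega

theorem rule_symbol_lt_base {q a q' b : ℕ} (h : x.1.lookup (q, a) = some (q', Sum.inr b)) :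
    b < base x := by
  have h1 := encode_rule_lt_base x (mem_of_lookup h)
  have h2 := Nat.right_le_pair (Encodable.encode q') (Encodable.encode (Sum.inr b : Bool ⊕ ℕ))
  rw [encode_prod_eq] at h1
  simp only [Encodable.encode_nat, Encodable.encode_inr] at *
  omega

/-! #### Correctness of the simulation -/

theorem step_eq (q : ℕ) (t : Tape ℕ) : TM0.step x.1.toMachine ⟨q, t⟩ =
    (x.1.lookup (q, t.head)).map fun r => ⟨r.1, match r.2 with
      | Sum.inl true => t.move Dir.left
      | Sum.inl false => t.move Dir.right
      | Sum.inr b => t.write b⟩ := by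
  rcases h : x.1.lookup (q, t.head) with - | ⟨q', (_ | _) | b⟩ <;>
    simp [TM0.step, toMachine, h]

/-- Uniqueness of Euclidean division. The quotient `c` is only assumed to be an integer, so
integrality alone certifies a guessed digit. -/
theorem digit_eq {B r b : ℕ} {c : ℤ} (hb : b < B) (h : (r : ℤ) - b = c * B) :
    b = r % B ∧ c = (r / B : ℕ) := by
  have h1 : (r : ℤ) = b + B * c := by linarith
  have hB : (B : ℤ) ≠ 0 := by omega
  have hb0 : (b : ℤ) / B = 0 := Int.ediv_eq_zero_of_lt (by positivity) (by exact_mod_cast hb)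
  have hb1 : (b : ℤ) % B = b := Int.emod_eq_of_lt (by positivity) (by exact_mod_cast hb)
  constructor
  · zify; rw [h1, Int.add_mul_emod_self_left, hb1]
  · push_cast; rw [h1, Int.add_mul_ediv_left _ _ hB, hb0, zero_add]

/-- Soundness of the digit check: in units of the new scale `base x * p`, the merged stacks have the
value `(base x * l + a) + (r - b) / base x`. If this is an integer, `base x` divides `r - b`.
Checking the sum lets one state serve both directions of the head. -/
theorem value_verState_pushPop {q a b l r k : ℕ} {p : ℤ} (hp : 0 < p) (hb : b < base x)
    (h : (linAut x).value k (verState q b)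
      ((Mat3.pushPop (base x) a b).app (p, p * l, p * r))) :
    b = r % base x ∧ ∃ j < k, (linAut x).value j (simState q b)
      (base x * p, base x * p * (base x * l + a : ℕ), base x * p * (r / base x : ℕ)) := by
  have hB : (0 : ℤ) < base x := by exact_mod_cast base_pos x
  cases k with
  | zero => exact absurd h (value_verState_zero x _ _ _)
  | succ k =>
    rw [Mat3.app_pushPop, value_verState_succ x k q b (by positivity)] at h
    obtain ⟨m, hm⟩ := exists_of_value_natCheck x (by positivity) _ _ h.2
    -- The result of the natural-number check, divided by `p` and solved for the part popped from
    -- the stack.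
    have e : (r : ℤ) - b = (m - (base x * l + a)) * base x := by
      apply mul_left_cancel₀ hp.ne'; linear_combination hm
    obtain ⟨h1, h2⟩ := digit_eq hb e
    refine ⟨h1, k, Nat.lt_succ_self k, ?_⟩
    convert h.1 using 3
    · push_cast; ring
    · rw [← h2]; linear_combination -p * e

theorem value_verState_popPush {q a b l r k : ℕ} {p : ℤ} (hp : 0 < p) (hb : b < base x)
    (h : (linAut x).value k (verState q b)
      ((Mat3.popPush (base x) a b).app (p, p * l, p * r))) :
    b = l % base x ∧ ∃ j < k, (linAut x).value j (simState q b)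
      (base x * p, base x * p * (l / base x : ℕ), base x * p * (base x * r + a : ℕ)) := by
  have hB : (0 : ℤ) < base x := by exact_mod_cast base_pos x
  cases k with
  | zero => exact absurd h (value_verState_zero x _ _ _)
  | succ k =>
    rw [Mat3.app_popPush, value_verState_succ x k q b (by positivity)] at h
    obtain ⟨m, hm⟩ := exists_of_value_natCheck x (by positivity) _ _ h.2
    have e : (l : ℤ) - b = (m - (base x * r + a)) * base x := by
      apply mul_left_cancel₀ hp.ne'; linear_combination hm
    obtain ⟨h1, h2⟩ := digit_eq hb e
    refine ⟨h1, k, Nat.lt_succ_self k, ?_⟩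
    convert h.1 using 3
    · rw [← h2]; linear_combination -p * e
    · push_cast; ring

theorem eval_dom_of_step {σ : Type} {f : σ → Option σ} {a b : σ} (h : f a = some b) :
    (StateTransition.eval f a).Dom ↔ (StateTransition.eval f b).Dom := by
  rw [StateTransition.reaches_eval (Relation.ReflTransGen.single (show b ∈ f a from h))]

theorem eval_dom_of_halted {σ : Type} {f : σ → Option σ} {a : σ} (h : f a = none) :
    (StateTransition.eval f a).Dom :=
  Part.dom_iff_mem.2 ⟨a, StateTransition.mem_eval.2 ⟨Relation.ReflTransGen.refl, h⟩⟩

/-- Only correct guesses survive, so a true node follows the run of the machine until no rule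
applies. The induction is strong because a head movement costs two steps, guess and verification,
while a write costs one. -/
theorem halts_of_value (k : ℕ) : ∀ {q a l r : ℕ} {p : ℤ} {t : Tape ℕ}, 0 < p →
    TapeRep (base x) t a l r → (linAut x).value k (simState q a) (p, p * l, p * r) →
    (StateTransition.eval (TM0.step x.1.toMachine) ⟨q, t⟩).Dom := by
  induction k using Nat.strong_induction_on with
  | _ k ih =>
    intro q a l r p t hp ht h
    have hB : (0 : ℤ) < base x := by exact_mod_cast base_pos x
    have hs := step_eq x q t
    rw [ht.head_eq] at hs
    obtain - | k := k
    · exact absurd h (value_simState_zero x _ _ _)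
    obtain ⟨m, hm, -, hv⟩ := (value_simState_succ x _ _ _ _).1 h
    rcases hl : x.1.lookup (q, a) with - | ⟨q', (_ | _) | b⟩ <;>
      simp only [hl, Option.map_none, Option.map_some] at hs <;>
      simp only [simMoves, hl, ruleMoves, List.mem_map, List.mem_range, List.mem_singleton] at hm
    · exact eval_dom_of_halted hs
    · obtain ⟨b, hb, rfl⟩ := hm
      obtain ⟨rfl, j, hj, hv⟩ := value_verState_pushPop x hp hb hv
      exact (eval_dom_of_step hs).2 (ih j (by omega) (by positivity) ht.move_right hv)
    · obtain ⟨b, hb, rfl⟩ := hm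
      obtain ⟨rfl, j, hj, hv⟩ := value_verState_popPush x hp hb hv
      exact (eval_dom_of_step hs).2 (ih j (by omega) (by positivity) ht.move_left hv)
    · subst hm
      rw [Mat3.app_one] at hv
      exact (eval_dom_of_step hs).2
        (ih k (by omega) hp (ht.write (rule_symbol_lt_base x hl)) hv)

/-- Backward induction along the run. The bound must be uniform in the scale `p`, since each head
movement multiplies it by the base. -/
theorem value_of_halts {c c' : TM0.Cfg ℕ ℕ} (hc : TM0.step x.1.toMachine c' = none)
    (h : StateTransition.Reaches (TM0.step x.1.toMachine) c c') :
    ∀ {a l r : ℕ}, TapeRep (base x) c.Tape a l r →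
      ∃ K, ∀ k ≥ K, ∀ p : ℤ, 0 < p → (linAut x).value k (simState c.q a) (p, p * l, p * r) := by
  have hB : (0 : ℤ) < base x := by exact_mod_cast base_pos x
  induction h using Relation.ReflTransGen.head_induction_on with
  | refl =>
    intro a l r ht
    refine ⟨1, fun k hk p hp => ?_⟩
    obtain ⟨k, rfl⟩ : ∃ j, k = j + 1 := ⟨k - 1, by omega⟩
    obtain ⟨q, t⟩ := c'
    rw [step_eq, Option.map_eq_none_iff, ht.head_eq] at hc
    rw [value_simState_succ]
    refine ⟨(Mat3.one, 1), by simp [simMoves, hc], ?_, value_accept x _ _⟩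
    simp [hp.ne']
  | @head c d hcd _ ih =>
    intro a l r ht
    obtain ⟨q, t⟩ := c
    rw [Option.mem_def, step_eq, ht.head_eq] at hcd
    have key : ∀ {a' l' r' : ℕ}, TapeRep (base x) d.Tape a' l' r' → ∃ K, ∀ k ≥ K, ∀ p : ℤ, 0 < p →
        (linAut x).value k (verState d.q a') (p, p * l', p * r') := by
      intro a' l' r' ht'
      obtain ⟨K, hK⟩ := ih ht'
      -- One step is spent in the verifying state; the check of the number `l' + r'` then takes `l'
      -- + r' + 2` steps.
      refine ⟨K + l' + r' + 3, fun k hk p hp => ?_⟩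
      obtain ⟨k, rfl⟩ : ∃ j, k = j + 1 := ⟨k - 1, by omega⟩
      refine (value_verState_succ x k _ _ hp _ _).2 ⟨hK k (by omega) p hp, ?_⟩
      convert value_natCheck_of_le x hp (l' + r') k (by omega) using 3
      push_cast; ring
    rcases hl : x.1.lookup (q, a) with - | ⟨q', (_ | _) | b⟩ <;>
      simp only [hl, Option.map_none, Option.map_some, Option.some.injEq, reduceCtorEq] at hcd <;>
      subst hcd
    · obtain ⟨K, hK⟩ := key ht.move_right
      refine ⟨K + 1, fun k hk p hp => ?_⟩
      obtain ⟨k, rfl⟩ : ∃ j, k = j + 1 := ⟨k - 1, by omega⟩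
      rw [value_simState_succ]
      -- The existential player guesses the true last digit of the right stack.
      refine ⟨(Mat3.pushPop (base x) a (r % base x), verState q' (r % base x)), ?_, ?_, ?_⟩
      · simp only [simMoves, hl, ruleMoves, List.mem_map, List.mem_range]
        exact ⟨_, Nat.mod_lt _ (base_pos x), rfl⟩
      · simp [hp.ne', (base_pos x).ne']
      · convert hK k (by omega) (base x * p) (by positivity) using 1
        have e : (r : ℤ) = base x * (r / base x : ℕ) + (r % base x : ℕ) := by
          exact_mod_cast (Nat.div_add_mod r (base x)).symm
        rw [Mat3.app_pushPop]
        refine Prod.ext rfl (Prod.ext ?_ ?_)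
        · push_cast; ring
        · linear_combination p * e
    · obtain ⟨K, hK⟩ := key ht.move_left
      refine ⟨K + 1, fun k hk p hp => ?_⟩
      obtain ⟨k, rfl⟩ : ∃ j, k = j + 1 := ⟨k - 1, by omega⟩
      rw [value_simState_succ]
      refine ⟨(Mat3.popPush (base x) a (l % base x), verState q' (l % base x)), ?_, ?_, ?_⟩
      · simp only [simMoves, hl, ruleMoves, List.mem_map, List.mem_range]
        exact ⟨_, Nat.mod_lt _ (base_pos x), rfl⟩
      · simp [hp.ne', (base_pos x).ne']
      · convert hK k (by omega) (base x * p) (by positivity) using 1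
        have e : (l : ℤ) = base x * (l / base x : ℕ) + (l % base x : ℕ) := by
          exact_mod_cast (Nat.div_add_mod l (base x)).symm
        rw [Mat3.app_popPush]
        refine Prod.ext rfl (Prod.ext ?_ ?_)
        · linear_combination p * e
        · push_cast; ring
    · obtain ⟨K, hK⟩ := ih (ht.write (rule_symbol_lt_base x hl))
      refine ⟨K + 1, fun k hk p hp => ?_⟩
      obtain ⟨k, rfl⟩ : ∃ j, k = j + 1 := ⟨k - 1, by omega⟩
      rw [value_simState_succ]
      refine ⟨(Mat3.one, simState q' b), by simp [simMoves, hl, ruleMoves], ?_, ?_⟩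
      · simp [hp.ne']
      · rw [Mat3.app_one]; exact hK k (by omega) p hp

theorem tapeRep_init : TapeRep (base x) (Tape.mk₁ x.2) x.2.headI 0
    (digitsVal (base x) x.2.tail) where
  head_eq := by cases x.2 <;> rfl
  head_lt := by
    cases h : x.2 with
    | nil => exact base_pos x
    | cons a l => exact lt_base_of_mem_input x (by simp [h])
  left := fun i => by
    have : (Tape.mk₁ x.2).left = ListBlank.mk [] := rfl
    rw [this]; simp [ListBlank.nth_mk]
  right := by
    have : (Tape.mk₁ x.2).right = ListBlank.mk x.2.tail := by cases x.2 <;> rfl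
    rw [this]
    exact halfTape_mk (base_pos x) _ fun a ha =>
      lt_base_of_mem_input x (List.mem_of_mem_tail ha)

theorem value_start_succ (k : ℕ) : (linAut x).value (k + 1) 4 (1, 0, 0) ↔
    (linAut x).value k (simState 0 x.2.headI) (1, 0, digitsVal (base x) x.2.tail) := by
  rw [LinAut.value_succ_of_existential (by simp [linAut, specials])]
  simp [linAut, specials]

theorem halts_iff_eval_dom (T : TMCode) (w : List ℕ) : T.Halts w ↔
    (StateTransition.eval (TM0.step T.toMachine) ⟨0, Tape.mk₁ w⟩).Dom := Iff.rfl

theorem halts_of_value_start {k : ℕ} (h : (linAut x).value k 4 (1, 0, 0)) : x.1.Halts x.2 := by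
  cases k with
  | zero => simp [LinAut.value] at h
  | succ k =>
    rw [value_start_succ] at h
    rw [halts_iff_eval_dom]
    exact halts_of_value x k one_pos (tapeRep_init x) (by simpa using h)

theorem value_start_of_halts (h : x.1.Halts x.2) :
    ∃ K, ∀ k ≥ K, (linAut x).value k 4 (1, 0, 0) := by
  rw [halts_iff_eval_dom, Part.dom_iff_mem] at h
  obtain ⟨c, hc⟩ := h
  rw [StateTransition.mem_eval] at hc
  obtain ⟨K, hK⟩ := value_of_halts x hc.2 hc.1 (tapeRep_init x)
  refine ⟨K + 1, fun k hk => ?_⟩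
  obtain ⟨k, rfl⟩ : ∃ j, k = j + 1 := ⟨k - 1, by omega⟩
  rw [value_start_succ]
  simpa using hK k (by omega) 1 one_pos

end TMCode

/-! ### Computability of integer operations and of maps over lists -/

theorem Primrec.int_ofNat : Primrec (fun n : ℕ => (n : ℤ)) :=
  Primrec.encode_iff.1 (Primrec.nat_double.of_eq fun _ => rfl)

theorem Int.encode_natCast (n : ℕ) : Encodable.encode (n : ℤ) = 2 * n := rfl

theorem Int.encode_negSucc (n : ℕ) : Encodable.encode (Int.negSucc n) = 2 * n + 1 := rfl

theorem Primrec.int_natAbs : Primrec Int.natAbs :=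
  -- Integers are coded by `n ↦ 2 * n` and `-(n + 1) ↦ 2 * n + 1`, so the absolute value is half the
  -- code, rounded up.
  (Primrec.nat_div.comp (Primrec.succ.comp Primrec.encode) (Primrec.const 2)).of_eq fun z => by
    cases z with
    | ofNat n =>
      have := Int.encode_natCast n
      simp only [Int.ofNat_eq_natCast, this, Int.natAbs_natCast]; omega
    | negSucc n => simp only [Int.encode_negSucc, Int.natAbs_negSucc]; omega

/-- On codes, negation fixes `0` and exchanges `2 * n + 1` with `2 * n + 2`. -/
theorem Primrec.int_neg : Primrec (fun z : ℤ => -z) := by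
  refine Primrec.encode_iff.1 ((Primrec.ite (c := fun z : ℤ => Encodable.encode z = 0)
    (Primrec.eq.comp Primrec.encode (Primrec.const 0)) (Primrec.const 0)
    (Primrec.ite (c := fun z : ℤ => Encodable.encode z % 2 = 0)
      (Primrec.eq.comp (Primrec.nat_mod.comp Primrec.encode (Primrec.const 2)) (Primrec.const 0))
      (Primrec.pred.comp Primrec.encode) (Primrec.succ.comp Primrec.encode))).of_eq fun z => ?_)
  rcases z with (_ | n) | n
  · rfl
  · have h1 := Int.encode_natCast (n + 1)
    have h2 := Int.encode_negSucc n
    have h3 : -(Int.ofNat (n + 1)) = Int.negSucc n := rfl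
    rw [h3, h2, Int.ofNat_eq_natCast, h1, if_neg (by omega), if_pos (by omega)]
    rfl
  · have h1 := Int.encode_negSucc n
    have h2 := Int.encode_natCast (n + 1)
    rw [Int.neg_negSucc, h2, h1, if_neg (by omega), if_neg (by omega)]
    omega

/-- The renaming of amplitudes is merely computable, so the list is built by recursion on the index,
each stage holding the image of a prefix. -/
theorem Computable.list_map {α β : Type} [Primcodable α] [Primcodable β] {f : α → β}
    (hf : Computable f) : Computable (List.map f) := by
  have hs : Primrec fun q : Option β × β => [q.2] :=
    Primrec.list_cons.comp Primrec.snd (Primrec.const [])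
  have ht : Primrec (Option.toList : Option β → List β) :=
    (Primrec.option_casesOn Primrec.id (Primrec.const []) hs.to₂).of_eq fun o => by
      cases o <;> rfl
  have hget : Computable fun t : List α × ℕ × List β => t.1[t.2.1]? :=
    Computable.list_getElem?.comp Computable.fst (Computable.fst.comp Computable.snd)
  have hmap : Computable fun t : List α × ℕ × List β => (t.1[t.2.1]?).map f :=
    Computable.option_map hget (hf.comp Computable.snd).to₂
  have hstep : Computable fun t : List α × ℕ × List β => t.2.2 ++ ((t.1[t.2.1]?).map f).toList :=
    Computable.list_append.comp (Computable.snd.comp Computable.snd) (ht.to_comp.comp hmap)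
  have h : Computable fun l : List α => Nat.rec (motive := fun _ => List β) []
      (fun n acc => acc ++ ((l[n]?).map f).toList) l.length :=
    Computable.nat_rec Computable.list_length (Computable.const []) hstep.to₂
  refine h.of_eq fun l => ?_
  have key : ∀ n ≤ l.length, Nat.rec (motive := fun _ => List β) []
      (fun n acc => acc ++ ((l[n]?).map f).toList) n = (l.take n).map f := by
    intro n
    induction n with
    | zero => simp
    | succ n ih =>
      intro hn
      simp only [ih (by omega), List.take_add_one, List.map_append]
      rw [List.getElem?_eq_getElem (by omega)]
      simp
  rw [key _ le_rfl, List.take_length]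

/-! ### Completing a list of integer matrices to a superoperator -/

namespace Mat3

/-- The sum of the squares of the entries of a row. -/
def rowSq (v : Vec3) : ℕ :=
  v.1.natAbs * v.1.natAbs + (v.2.1.natAbs * v.2.1.natAbs + v.2.2.natAbs * v.2.2.natAbs)

/-- The sum of the squares of the entries. -/
def normSq (m : Mat3) : ℕ := rowSq m.1 + (rowSq m.2.1 + rowSq m.2.2)

/-- The row `v`, multiplied on the right by the `g`-th quaternion unit and by `1 / (S + 1)`. -/
def rowCode (S g : ℕ) (v : Vec3) : List (ℤ × ℕ) :=
  (([[v.1, v.2.1, v.2.2, 0], [-v.2.1, v.1, 0, v.2.2], [-v.2.2, 0, v.1, -v.2.1],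
    [0, -v.2.2, v.2.1, v.1]][g]?).getD []).map fun z => (z, S)

/-- The matrix `m`, multiplied on the right by the `g`-th quaternion unit and by `1 / (S + 1)`. -/
def opCode (S g : ℕ) (m : Mat3) : List (List (ℤ × ℕ)) :=
  [rowCode S g m.1, rowCode S g m.2.1, rowCode S g m.2.2]

end Mat3

/-- The `4 × 4` identity matrix, divided by `S + 1`. -/
def scalarCode (S : ℕ) : List (List (ℤ × ℕ)) :=
  [[(1, S), (0, S), (0, S), (0, S)], [(0, S), (1, S), (0, S), (0, S)],
    [(0, S), (0, S), (1, S), (0, S)], [(0, S), (0, S), (0, S), (1, S)]]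

/-- The sum of the squares of the entries of all the matrices in the list. -/
def totalSq (moves : List (Mat3 × ℕ)) : ℕ := moves.foldr (fun m n => m.1.normSq + n) 0

/-- The outcomes of a superoperator that performs the given moves or enters the state `sink`. -/
def superopCode (sink : ℕ) (moves : List (Mat3 × ℕ)) : SuperopCode (ℤ × ℕ) :=
  moves.map (fun m => (m.1.opCode (totalSq moves) 0, m.2)) ++
    (moves.flatMap (fun m => [(m.1.opCode (totalSq moves) 1, sink),
        (m.1.opCode (totalSq moves) 2, sink), (m.1.opCode (totalSq moves) 3, sink)]) ++
      (List.range (totalSq moves * totalSq moves + totalSq moves + 1)).map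
        fun _ => (scalarCode (totalSq moves), sink))

namespace TMCode

/-- The description of the state `i` of the automaton. -/
def stateCode (x : TMCode × List ℕ) (i : ℕ) :
    Bool × Bool × SuperopCode (ℤ × ℕ) × SuperopCode (ℤ × ℕ) :=
  ((linAut x i).1, decide (i = 1),
    superopCode (cond (linAut x i).1 0 1) (linAut x i).2,
    superopCode (cond (linAut x i).1 0 1) (linAut x i).2)

/-- The number of states of the automaton. -/
def numStates (x : TMCode × List ℕ) : ℕ := 5 + 2 * (base x * base x)

/-- The AQFA that simulates a Turing machine on an input. -/
def aqfaCode (x : TMCode × List ℕ) : AQFACode (ℤ × ℕ) :=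
  ((List.range (numStates x)).map (stateCode x), 4, 4, 0)

end TMCode

/-! ### The AQFA is computable from the Turing machine and its input -/

namespace Mat3

theorem primrec_rowSq : Primrec rowSq := by
  have h : Primrec fun z : ℤ => z.natAbs * z.natAbs :=
    Primrec.nat_mul.comp Primrec.int_natAbs Primrec.int_natAbs
  exact Primrec.nat_add.comp (h.comp Primrec.fst) (Primrec.nat_add.comp
    (h.comp (Primrec.fst.comp Primrec.snd)) (h.comp (Primrec.snd.comp Primrec.snd)))

theorem primrec_normSq : Primrec normSq :=
  Primrec.nat_add.comp (primrec_rowSq.comp Primrec.fst) (Primrec.nat_add.comp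
    (primrec_rowSq.comp (Primrec.fst.comp Primrec.snd))
    (primrec_rowSq.comp (Primrec.snd.comp Primrec.snd)))

end Mat3

theorem Primrec.list_two {α β : Type} [Primcodable α] [Primcodable β] {f g : α → β}
    (hf : Primrec f) (hg : Primrec g) : Primrec fun a => [f a, g a] :=
  Primrec.list_cons.comp hf (Primrec.list_cons.comp hg (Primrec.const []))

theorem Primrec.list_three {α β : Type} [Primcodable α] [Primcodable β] {f g h : α → β}
    (hf : Primrec f) (hg : Primrec g) (hh : Primrec h) : Primrec fun a => [f a, g a, h a] :=
  Primrec.list_cons.comp hf (Primrec.list_two hg hh)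

theorem Primrec.list_four {α β : Type} [Primcodable α] [Primcodable β] {f g h k : α → β}
    (hf : Primrec f) (hg : Primrec g) (hh : Primrec h) (hk : Primrec k) :
    Primrec fun a => [f a, g a, h a, k a] :=
  Primrec.list_cons.comp hf (Primrec.list_three hg hh hk)

namespace Mat3

theorem primrec_rowCode (g : ℕ) : Primrec₂ fun S v => rowCode S g v := by
  have h1 : Primrec fun p : ℕ × Vec3 => p.2.1 := Primrec.fst.comp Primrec.snd
  have h2 : Primrec fun p : ℕ × Vec3 => p.2.2.1 :=
    Primrec.fst.comp (Primrec.snd.comp Primrec.snd)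
  have h3 : Primrec fun p : ℕ × Vec3 => p.2.2.2 :=
    Primrec.snd.comp (Primrec.snd.comp Primrec.snd)
  have h0 : Primrec fun _ : ℕ × Vec3 => (0 : ℤ) := Primrec.const 0
  refine Primrec.list_map (Primrec.option_getD.comp (Primrec.list_getElem?.comp
    (Primrec.list_four (Primrec.list_four h1 h2 h3 h0)
      (Primrec.list_four (Primrec.int_neg.comp h2) h1 h0 h3)
      (Primrec.list_four (Primrec.int_neg.comp h3) h0 h1 (Primrec.int_neg.comp h2))
      (Primrec.list_four h0 (Primrec.int_neg.comp h3) h2 h1)) (Primrec.const g))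
    (Primrec.const [])) ?_
  exact (Primrec.pair Primrec.snd (Primrec.fst.comp Primrec.fst)).to₂

theorem primrec_opCode (g : ℕ) : Primrec₂ fun S m => opCode S g m := by
  have h := primrec_rowCode g
  exact Primrec.list_three (h.comp Primrec.fst (Primrec.fst.comp Primrec.snd))
    (h.comp Primrec.fst (Primrec.fst.comp (Primrec.snd.comp Primrec.snd)))
    (h.comp Primrec.fst (Primrec.snd.comp (Primrec.snd.comp Primrec.snd)))

end Mat3

theorem primrec_scalarCode : Primrec scalarCode := by
  have h0 : Primrec fun S : ℕ => ((0 : ℤ), S) := Primrec.pair (Primrec.const 0) Primrec.id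
  have h1 : Primrec fun S : ℕ => ((1 : ℤ), S) := Primrec.pair (Primrec.const 1) Primrec.id
  exact Primrec.list_four (Primrec.list_four h1 h0 h0 h0) (Primrec.list_four h0 h1 h0 h0)
    (Primrec.list_four h0 h0 h1 h0) (Primrec.list_four h0 h0 h0 h1)

theorem primrec_totalSq : Primrec totalSq :=
  Primrec.list_foldr Primrec.id (Primrec.const 0)
    (Primrec.nat_add.comp
      (Mat3.primrec_normSq.comp (Primrec.fst.comp (Primrec.fst.comp Primrec.snd)))
      (Primrec.snd.comp Primrec.snd)).to₂

theorem primrec_superopCode : Primrec₂ superopCode := by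
  have hS : Primrec fun p : ℕ × List (Mat3 × ℕ) => totalSq p.2 :=
    primrec_totalSq.comp Primrec.snd
  have hop : ∀ g, Primrec fun q : (ℕ × List (Mat3 × ℕ)) × (Mat3 × ℕ) =>
      q.2.1.opCode (totalSq q.1.2) g := fun g =>
    (Mat3.primrec_opCode g).comp (hS.comp Primrec.fst) (Primrec.fst.comp Primrec.snd)
  have hsink : Primrec fun q : (ℕ × List (Mat3 × ℕ)) × (Mat3 × ℕ) => q.1.1 :=
    Primrec.fst.comp Primrec.fst
  refine Primrec.list_append.comp (Primrec.list_map Primrec.snd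
    (Primrec.pair (hop 0) (Primrec.snd.comp Primrec.snd)).to₂) (Primrec.list_append.comp
    (Primrec.list_flatMap Primrec.snd (Primrec.list_three (Primrec.pair (hop 1) hsink)
      (Primrec.pair (hop 2) hsink) (Primrec.pair (hop 3) hsink)).to₂)
    (Primrec.list_map (Primrec.list_range.comp (Primrec.succ.comp
      (Primrec.nat_add.comp (Primrec.nat_mul.comp hS hS) hS)))
      (Primrec.pair (primrec_scalarCode.comp (hS.comp Primrec.fst))
        (Primrec.fst.comp Primrec.fst)).to₂))

namespace TMCode

theorem primrec_base : Primrec base := Primrec.succ.comp Primrec.encode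

theorem primrec_simState : Primrec₂ simState :=
  Primrec.nat_add.comp (Primrec.const 5) (Primrec.nat_double.comp Primrec₂.natPair)

theorem primrec_verState : Primrec₂ verState :=
  Primrec.nat_add.comp (Primrec.const 6) (Primrec.nat_double.comp Primrec₂.natPair)

theorem primrec_digitsVal : Primrec₂ digitsVal :=
  Primrec.list_foldr Primrec.snd (Primrec.const 0)
    (Primrec.nat_add.comp (Primrec.fst.comp Primrec.snd)
      (Primrec.nat_mul.comp (Primrec.fst.comp Primrec.fst) (Primrec.snd.comp Primrec.snd))).to₂

theorem primrec_load : Primrec Mat3.load :=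
  Primrec.pair (Primrec.const _) (Primrec.pair (Primrec.const _)
    (Primrec.pair Primrec.int_ofNat (Primrec.const _)))

theorem primrec_pushPop : Primrec fun t : ℕ × ℕ × ℕ => Mat3.pushPop t.1 t.2.1 t.2.2 := by
  have hB : Primrec fun t : ℕ × ℕ × ℕ => t.1 := Primrec.fst
  have ha : Primrec fun t : ℕ × ℕ × ℕ => t.2.1 := Primrec.fst.comp Primrec.snd
  have hb : Primrec fun t : ℕ × ℕ × ℕ => t.2.2 := Primrec.snd.comp Primrec.snd
  exact Primrec.pair (Primrec.pair (Primrec.int_ofNat.comp hB) (Primrec.const _))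
    (Primrec.pair (Primrec.pair (Primrec.int_ofNat.comp (Primrec.nat_mul.comp hB ha))
      (Primrec.pair (Primrec.int_ofNat.comp (Primrec.nat_mul.comp hB hB)) (Primrec.const _)))
    (Primrec.pair (Primrec.int_neg.comp (Primrec.int_ofNat.comp hb)) (Primrec.const _)))

theorem primrec_popPush : Primrec fun t : ℕ × ℕ × ℕ => Mat3.popPush t.1 t.2.1 t.2.2 := by
  have hB : Primrec fun t : ℕ × ℕ × ℕ => t.1 := Primrec.fst
  have ha : Primrec fun t : ℕ × ℕ × ℕ => t.2.1 := Primrec.fst.comp Primrec.snd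
  have hb : Primrec fun t : ℕ × ℕ × ℕ => t.2.2 := Primrec.snd.comp Primrec.snd
  exact Primrec.pair (Primrec.pair (Primrec.int_ofNat.comp hB) (Primrec.const _))
    (Primrec.pair (Primrec.pair (Primrec.int_neg.comp (Primrec.int_ofNat.comp hb))
      (Primrec.const _))
    (Primrec.pair (Primrec.int_ofNat.comp (Primrec.nat_mul.comp hB ha))
      (Primrec.pair (Primrec.const _) (Primrec.int_ofNat.comp (Primrec.nat_mul.comp hB hB)))))

theorem primrec_digitMoves : Primrec fun t : (ℕ × ℕ × ℕ) × Bool =>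
    (List.range t.1.1).map fun b =>
      (cond t.2 (Mat3.popPush t.1.1 t.1.2.1 b) (Mat3.pushPop t.1.1 t.1.2.1 b),
        verState t.1.2.2 b) := by
  have hargs : Primrec fun u : ((ℕ × ℕ × ℕ) × Bool) × ℕ => (u.1.1.1, u.1.1.2.1, u.2) :=
    Primrec.pair (Primrec.fst.comp (Primrec.fst.comp Primrec.fst))
      (Primrec.pair (Primrec.fst.comp (Primrec.snd.comp (Primrec.fst.comp Primrec.fst)))
        Primrec.snd)
  have h1 : Primrec fun u : ((ℕ × ℕ × ℕ) × Bool) × ℕ => Mat3.popPush u.1.1.1 u.1.1.2.1 u.2 :=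
    (primrec_popPush.comp hargs).of_eq fun _ => rfl
  have h2 : Primrec fun u : ((ℕ × ℕ × ℕ) × Bool) × ℕ => Mat3.pushPop u.1.1.1 u.1.1.2.1 u.2 :=
    (primrec_pushPop.comp hargs).of_eq fun _ => rfl
  have h : Primrec fun u : ((ℕ × ℕ × ℕ) × Bool) × ℕ =>
      (cond u.1.2 (Mat3.popPush u.1.1.1 u.1.1.2.1 u.2) (Mat3.pushPop u.1.1.1 u.1.1.2.1 u.2),
        verState u.1.1.2.2 u.2) :=
    Primrec.pair (Primrec.cond (Primrec.snd.comp Primrec.fst) h1 h2)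
      (primrec_verState.comp
        (Primrec.snd.comp (Primrec.snd.comp (Primrec.fst.comp Primrec.fst))) Primrec.snd)
  exact Primrec.list_map (Primrec.list_range.comp (Primrec.fst.comp Primrec.fst)) h.to₂

theorem primrec_ruleMoves : Primrec fun t : (ℕ × ℕ) × (ℕ × (Bool ⊕ ℕ)) =>
    ruleMoves t.1.1 t.1.2 t.2 := by
  have h1 : Primrec fun u : ((ℕ × ℕ) × (ℕ × (Bool ⊕ ℕ))) × Bool =>
      (List.range u.1.1.1).map fun b =>
        (cond u.2 (Mat3.popPush u.1.1.1 u.1.1.2 b) (Mat3.pushPop u.1.1.1 u.1.1.2 b),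
          verState u.1.2.1 b) :=
    primrec_digitMoves.comp (Primrec.pair
      (Primrec.pair (Primrec.fst.comp (Primrec.fst.comp Primrec.fst))
        (Primrec.pair (Primrec.snd.comp (Primrec.fst.comp Primrec.fst))
          (Primrec.fst.comp (Primrec.snd.comp Primrec.fst)))) Primrec.snd)
  have h2 : Primrec fun u : ((ℕ × ℕ) × (ℕ × (Bool ⊕ ℕ))) × ℕ =>
      [(Mat3.one, simState u.1.2.1 u.2)] :=
    Primrec.list_cons.comp (Primrec.pair (Primrec.const _)
      (primrec_simState.comp (Primrec.fst.comp (Primrec.snd.comp Primrec.fst)) Primrec.snd))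
      (Primrec.const [])
  exact (Primrec.sumCasesOn (Primrec.snd.comp Primrec.snd) h1.to₂ h2.to₂).of_eq fun _ => rfl

theorem primrec_simMoves : Primrec fun t : TMCode × ℕ × ℕ × ℕ =>
    simMoves t.1 t.2.1 t.2.2.1 t.2.2.2 := by
  have h : Primrec fun u : (TMCode × ℕ × ℕ × ℕ) × (ℕ × (Bool ⊕ ℕ)) =>
      ruleMoves u.1.2.1 u.1.2.2.2 u.2 :=
    primrec_ruleMoves.comp (Primrec.pair
      (Primrec.pair (Primrec.fst.comp (Primrec.snd.comp Primrec.fst))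
        (Primrec.snd.comp (Primrec.snd.comp (Primrec.snd.comp Primrec.fst)))) Primrec.snd)
  -- The lookup proved primitive recursive and the one in `simMoves` use different equality tests on
  -- pairs; lawful tests coincide.
  have e : (instBEqOfDecidableEq : BEq (ℕ × ℕ)) = instBEqProd := lawful_beq_subsingleton _ _
  refine (Primrec.option_casesOn (Primrec.listLookup.comp (Primrec.snd.comp Primrec.snd)
    Primrec.fst) (Primrec.const [(Mat3.one, 1)]) h.to₂).of_eq fun t => ?_
  rw [e]
  rfl

theorem primrec_specials : Primrec specials := by
  refine Primrec.list_cons.comp (Primrec.const _) (Primrec.list_four (Primrec.const _)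
    (Primrec.const _) (Primrec.const _) ?_)
  exact Primrec.pair (Primrec.const _) (Primrec.list_cons.comp (Primrec.pair
    (primrec_load.comp (primrec_digitsVal.comp primrec_base (Primrec.list_tail.comp Primrec.snd)))
    (primrec_simState.comp (Primrec.const 0) (Primrec.list_headI.comp Primrec.snd)))
    (Primrec.const []))

theorem primrec_linAut : Primrec₂ linAut := by
  have hi : Primrec fun t : (TMCode × List ℕ) × ℕ => t.2 - 5 :=
    Primrec.nat_sub.comp Primrec.snd (Primrec.const 5)
  have hj : Primrec fun t : (TMCode × List ℕ) × ℕ => ((t.2 - 5) / 2).unpair :=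
    Primrec.unpair.comp (Primrec.nat_div.comp hi (Primrec.const 2))
  refine Primrec.option_getD.comp (Primrec.list_getElem?.comp
    (primrec_specials.comp Primrec.fst) Primrec.snd) (Primrec.cond
    (Primrec.eq.decide.comp (Primrec.nat_mod.comp hi (Primrec.const 2)) (Primrec.const 0))
    (Primrec.pair (Primrec.const _) ?_) (Primrec.pair (Primrec.const _)
      (Primrec.list_two (Primrec.pair (Primrec.const _)
        (primrec_simState.comp (Primrec.fst.comp hj) (Primrec.snd.comp hj))) (Primrec.const _))))
  exact primrec_simMoves.comp (Primrec.pair (Primrec.fst.comp Primrec.fst)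
    (Primrec.pair (primrec_base.comp Primrec.fst) hj))

theorem primrec_stateCode : Primrec₂ stateCode := by
  have h : Primrec fun t : (TMCode × List ℕ) × ℕ => linAut t.1 t.2 := primrec_linAut
  have h1 := Primrec.fst.comp h
  have h2 := primrec_superopCode.comp (Primrec.cond h1 (Primrec.const 0) (Primrec.const 1))
    (Primrec.snd.comp h)
  exact Primrec.pair h1 (Primrec.pair
    (Primrec.eq.decide.comp Primrec.snd (Primrec.const 1)) (Primrec.pair h2 h2))

theorem primrec_aqfaCode : Primrec aqfaCode :=
  Primrec.pair (Primrec.list_map (Primrec.list_range.comp (Primrec.nat_add.comp (Primrec.const 5)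
    (Primrec.nat_double.comp (Primrec.nat_mul.comp primrec_base primrec_base))))
    primrec_stateCode) (Primrec.const _)

end TMCode

/-! ### Well-formedness of the description -/

namespace AQFACode

variable {K L : Type}

/-- Rename the amplitudes of a superoperator. -/
def mapSuperop (e : K → L) (l : SuperopCode K) : SuperopCode L :=
  l.map fun o => (o.1.map (List.map e), o.2)

/-- Rename the amplitudes of an AQFA. -/
def mapAmp (e : K → L) (c : AQFACode K) : AQFACode L :=
  (c.1.map fun t => (t.1, t.2.1, mapSuperop e t.2.2.1, mapSuperop e t.2.2.2), c.2)

theorem computable_mapAmp [Primcodable K] [Primcodable L] {e : K → L} (he : Computable e) :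
    Computable (mapAmp e) := by
  have h1 : Computable fun o : List (List K) × ℕ => (o.1.map (List.map e), o.2) :=
    Computable.pair (he.list_map.list_map.comp Computable.fst) Computable.snd
  have h2 : Computable (mapSuperop e) := h1.list_map
  have h3 : Computable fun t : Bool × Bool × SuperopCode K × SuperopCode K =>
      (t.1, t.2.1, mapSuperop e t.2.2.1, mapSuperop e t.2.2.2) :=
    Computable.pair Computable.fst (Computable.pair (Computable.fst.comp Computable.snd)
      (Computable.pair (h2.comp (Computable.fst.comp (Computable.snd.comp Computable.snd)))
        (h2.comp (Computable.snd.comp (Computable.snd.comp Computable.snd)))))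
  exact Computable.pair (h3.list_map.comp Computable.fst) Computable.snd

theorem toMatrix_map {val : L → ℂ} {val' : K → ℂ} {e : K → L} (h : ∀ k, val (e k) = val' k)
    (d : ℕ) (rows : List (List K)) :
    toMatrix val d (rows.map (List.map e)) = toMatrix val' d rows := by
  have hv : val ∘ e = val' := funext h
  ext i j
  simp only [toMatrix, List.getElem?_map]
  rcases rows[(i : ℕ)]? with - | row
  · rfl
  · simp [Option.map_map, hv]

end AQFACode

open AQFACode

namespace Mat3

/-- The matrix `m`, extended by zeros and multiplied on the right by the quaternion unit `g`. -/
def quat (m : Mat3) : Fin 4 → Matrix (Fin 4) (Fin 4) ℤ :=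
  ![!![m.1.1, m.1.2.1, m.1.2.2, 0; m.2.1.1, m.2.1.2.1, m.2.1.2.2, 0;
      m.2.2.1, m.2.2.2.1, m.2.2.2.2, 0; 0, 0, 0, 0],
    !![-m.1.2.1, m.1.1, 0, m.1.2.2; -m.2.1.2.1, m.2.1.1, 0, m.2.1.2.2;
      -m.2.2.2.1, m.2.2.1, 0, m.2.2.2.2; 0, 0, 0, 0],
    !![-m.1.2.2, 0, m.1.1, -m.1.2.1; -m.2.1.2.2, 0, m.2.1.1, -m.2.1.2.1;
      -m.2.2.2.2, 0, m.2.2.1, -m.2.2.2.1; 0, 0, 0, 0],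
    !![0, -m.1.2.2, m.1.2.1, m.1.1; 0, -m.2.1.2.2, m.2.1.2.1, m.2.1.1;
      0, -m.2.2.2.2, m.2.2.2.1, m.2.2.1; 0, 0, 0, 0]]

theorem rowSq_cast (v : Vec3) : (rowSq v : ℤ) = v.1 ^ 2 + (v.2.1 ^ 2 + v.2.2 ^ 2) := by
  simp only [rowSq, Nat.cast_add, Nat.cast_mul, Int.natCast_natAbs, abs_mul_abs_self, sq]

/-- Multiplying a row `v`, viewed as a quaternion, by the four units gives four orthogonal vectors
of length `|v|`. They form `|v|` times an orthogonal matrix, so each row of `m` contributes `|v| ^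
2` times the identity. -/
theorem sum_quat (m : Mat3) :
    ∑ g, (m.quat g).transpose * m.quat g = (m.normSq : ℤ) • (1 : Matrix (Fin 4) (Fin 4) ℤ) := by
  obtain ⟨⟨a, b, c⟩, ⟨d, e, f⟩, ⟨g, h, i⟩⟩ := m
  simp only [normSq, Nat.cast_add, rowSq_cast]
  ext j k
  simp only [Fin.sum_univ_four, Matrix.add_apply, Matrix.mul_apply, Matrix.transpose_apply,
    Matrix.smul_apply]
  fin_cases j <;> fin_cases k <;> simp [quat] <;> ring

/-- The code lists only three rows; the zero fourth row comes from the default value in `toMatrix`.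
-/
theorem toMatrix_opCode (S : ℕ) (m : Mat3) (g : Fin 4) :
    toMatrix ratVal 4 (m.opCode S g) =
      ((S : ℂ) + 1)⁻¹ • (m.quat g).map (Int.cast : ℤ → ℂ) := by
  ext i j
  fin_cases g <;> fin_cases i <;> fin_cases j <;>
    simp [toMatrix, opCode, rowCode, ratVal, quat, div_eq_inv_mul]

theorem gram_smul_map (c : ℂ) (hc : star c = c) (N : Matrix (Fin 4) (Fin 4) ℤ) :
    (c • N.map (Int.cast : ℤ → ℂ)).conjTranspose * (c • N.map (Int.cast : ℤ → ℂ)) =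
      (c * c) • (N.transpose * N).map (Int.cast : ℤ → ℂ) := by
  ext i j
  simp only [Matrix.mul_apply, Matrix.conjTranspose_apply, Matrix.smul_apply, Matrix.map_apply,
    Matrix.transpose_apply, smul_eq_mul, star_mul', hc, Int.cast_sum, Int.cast_mul,
    Finset.mul_sum, star_intCast]
  exact Finset.sum_congr rfl fun _ _ => by ring

end Mat3

theorem star_inv_natCast_add_one (S : ℕ) : star ((S : ℂ) + 1)⁻¹ = ((S : ℂ) + 1)⁻¹ := by
  rw [star_inv₀, star_add, star_natCast, star_one]

theorem toMatrix_scalarCode (S : ℕ) :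
    toMatrix ratVal 4 (scalarCode S) = ((S : ℂ) + 1)⁻¹ • (1 : Matrix (Fin 4) (Fin 4) ℂ) := by
  ext i j
  fin_cases i <;> fin_cases j <;> simp [toMatrix, scalarCode, ratVal]

/-- The positive semidefinite matrix contributed by an operation element. -/
noncomputable def gram (rows : List (List (ℤ × ℕ))) : Matrix (Fin 4) (Fin 4) ℂ :=
  (toMatrix ratVal 4 rows).conjTranspose * toMatrix ratVal 4 rows

theorem gram_scalarCode (S : ℕ) : gram (scalarCode S) =
    (((S : ℂ) + 1)⁻¹ * ((S : ℂ) + 1)⁻¹) • (1 : Matrix (Fin 4) (Fin 4) ℂ) := by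
  simp only [gram, toMatrix_scalarCode, Matrix.conjTranspose_smul, star_inv_natCast_add_one,
    Matrix.conjTranspose_one, smul_mul_smul_comm, Matrix.one_mul]

theorem gram_opCode (S : ℕ) (m : Mat3) :
    gram (m.opCode S 0) + (gram (m.opCode S 1) + (gram (m.opCode S 2) + gram (m.opCode S 3))) =
      (((S : ℂ) + 1)⁻¹ * ((S : ℂ) + 1)⁻¹ * m.normSq) • (1 : Matrix (Fin 4) (Fin 4) ℂ) := by
  have h := congrArg (fun N : Matrix (Fin 4) (Fin 4) ℤ => N.map (Int.cast : ℤ → ℂ)) m.sum_quat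
  have hg : ∀ g : Fin 4, gram (m.opCode S g) = (((S : ℂ) + 1)⁻¹ * ((S : ℂ) + 1)⁻¹) •
      ((m.quat g).transpose * m.quat g).map (Int.cast : ℤ → ℂ) := fun g => by
    rw [gram, Mat3.toMatrix_opCode, Mat3.gram_smul_map _ (star_inv_natCast_add_one S)]
  have h0 := hg 0
  have h1 := hg 1
  have h2 := hg 2
  have h3 := hg 3
  simp only [Fin.isValue, Fin.coe_ofNat_eq_mod, Nat.zero_mod, Nat.one_mod, Nat.reduceMod]
    at h0 h1 h2 h3
  rw [h0, h1, h2, h3, ← smul_add, ← smul_add, ← smul_add, mul_smul _ (m.normSq : ℂ)]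
  congr 1
  ext i j
  have hij := congrFun (congrFun h i) j
  simp only [Fin.sum_univ_four, Matrix.map_apply, Matrix.add_apply, Matrix.smul_apply,
    Int.cast_add, Matrix.one_apply] at hij ⊢
  rw [← add_assoc, ← add_assoc, hij]
  split_ifs <;> simp

theorem totalSq_cast (moves : List (Mat3 × ℕ)) :
    (totalSq moves : ℂ) = (moves.map fun m => (m.1.normSq : ℂ)).sum := by
  induction moves with
  | nil => simp [totalSq]
  | cons m l ih => simp [totalSq, ← ih]

theorem sum_map_flatMap_three {α β M : Type} [AddCommMonoid M] (l : List α) (f g h : α → β)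
    (F : β → M) : ((l.flatMap fun a => [f a, g a, h a]).map F).sum =
      (l.map fun a => F (f a) + (F (g a) + F (h a))).sum := by
  induction l with
  | nil => simp
  | cons a l ih => simp [ih, add_assoc]

theorem sum_map_mul_smul {α R M : Type} [Semiring R] [AddCommMonoid M] [Module R M] (c : R)
    (f : α → R) (y : M) (l : List α) :
    (l.map fun a => (c * f a) • y).sum = (c * (l.map f).sum) • y := by
  induction l with
  | nil => simp
  | cons a l ih => simp [ih, mul_add, add_smul]

/-- With `S` the total of the squared entries, the moves and their quaternion companions contribute
`S / (S + 1) ^ 2`. The `S * S + S + 1` scalar outcomes supply the rest, as `S + (S ^ 2 + S + 1) = (S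
+ 1) ^ 2`. -/
theorem sum_gram_superopCode (sink : ℕ) (moves : List (Mat3 × ℕ)) :
    ((superopCode sink moves).map fun o => gram o.1).sum = 1 := by
  set S := totalSq moves with hS
  set c : ℂ := ((S : ℂ) + 1)⁻¹ * ((S : ℂ) + 1)⁻¹ with hc
  have hsum : (moves.map fun m => gram (m.1.opCode S 0) +
      (gram (m.1.opCode S 1) + (gram (m.1.opCode S 2) + gram (m.1.opCode S 3)))).sum =
      (c * S) • (1 : Matrix (Fin 4) (Fin 4) ℂ) := by
    simp only [gram_opCode, ← hc]
    rw [sum_map_mul_smul, hS, totalSq_cast]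
  rw [superopCode, ← hS, List.map_append, List.map_append, List.sum_append, List.sum_append,
    sum_map_flatMap_three, List.map_map, ← add_assoc, ← List.sum_map_add]
  have h2 : (((List.range (S * S + S + 1)).map fun _ => (scalarCode S, sink)).map
      fun o => gram o.1).sum =
        (c * ((S : ℂ) * S + S + 1)) • (1 : Matrix (Fin 4) (Fin 4) ℂ) := by
    simp only [List.map_map, Function.comp_def, gram_scalarCode, ← hc]
    rw [List.map_const', List.sum_replicate, List.length_range, ← Nat.cast_smul_eq_nsmul ℂ,
      smul_smul, mul_comm]
    push_cast
    rfl
  rw [h2]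
  simp only [Function.comp_def]
  rw [hsum, ← add_smul]
  have h3 : (S : ℂ) + 1 ≠ 0 := Nat.cast_add_one_ne_zero S
  have h4 : c * S + c * ((S : ℂ) * S + S + 1) = 1 := by
    rw [hc]; field_simp; ring
  rw [h4, one_smul]

namespace TMCode

variable (x : TMCode × List ℕ) {K : Type} {val : K → ℂ} {e : ℤ × ℕ → K}

/-- Pairs of numbers below `B` have pairing codes below `B ^ 2`, which explains the size of
`numStates`. -/
theorem lt_numStates_of_lt (q a : ℕ) (hq : q < base x) (ha : a < base x) :
    verState q a < numStates x := by
  have h := Nat.pair_lt_max_add_one_sq q a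
  have h1 : max q a + 1 ≤ base x := by omega
  have h2 : (max q a + 1) ^ 2 ≤ base x * base x := by rw [sq]; exact Nat.mul_le_mul h1 h1
  simp only [verState, numStates]; omega

theorem simState_lt_verState (q a : ℕ) : simState q a < verState q a := by
  simp only [simState, verState]; omega

theorem special_lt_numStates {i : ℕ} (h : i < 5) : i < numStates x := by
  simp only [numStates]; omega

theorem ruleMoves_lt {q a : ℕ} {r : ℕ × (Bool ⊕ ℕ)} (h : x.1.lookup (q, a) = some r)
    {m : Mat3 × ℕ} (hm : m ∈ ruleMoves (base x) a r) : m.2 < numStates x := by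
  have hq := rule_state_lt_base x h
  obtain ⟨q', d | b⟩ := r
  · simp only [ruleMoves, List.mem_map, List.mem_range] at hm
    obtain ⟨b, hb, rfl⟩ := hm
    exact lt_numStates_of_lt x _ _ hq hb
  · simp only [ruleMoves, List.mem_singleton] at hm
    subst hm
    exact (simState_lt_verState _ _).trans
      (lt_numStates_of_lt x _ _ hq (rule_symbol_lt_base x h))

theorem exists_state_eq {i : ℕ} (hi : 5 ≤ i) : ∃ q a, i = simState q a ∨ i = verState q a := by
  refine ⟨((i - 5) / 2).unpair.1, ((i - 5) / 2).unpair.2, ?_⟩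
  simp only [simState, verState, Nat.pair_unpair]
  omega

theorem headI_lt_base : x.2.headI < base x := (tapeRep_init x).head_lt

/-- The infinite family of states can be truncated: no move leaves the initial segment kept in the
description. -/
theorem linAut_moves_lt {i : ℕ} (hi : i < numStates x) {m : Mat3 × ℕ} (hm : m ∈ (linAut x i).2) :
    m.2 < numStates x := by
  rcases lt_or_ge i 5 with h | h
  · have hs := special_lt_numStates x (i := 0) (by omega)
    have hs2 := special_lt_numStates x (i := 2) (by omega)
    have hs3 := special_lt_numStates x (i := 3) (by omega)
    have hsim := (simState_lt_verState 0 x.2.headI).trans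
      (lt_numStates_of_lt x _ _ (base_pos x) (headI_lt_base x))
    interval_cases i <;> simp [linAut, specials] at hm
    · rcases hm with rfl | rfl <;> assumption
    · subst hm; exact hs
    · subst hm; exact hsim
  · obtain ⟨q, a, rfl | rfl⟩ := exists_state_eq h
    · rw [linAut_simState] at hm
      rcases hl : x.1.lookup (q, a) with - | r
      · simp only [simMoves, hl, List.mem_singleton] at hm
        subst hm
        exact special_lt_numStates x (by omega)
      · simp only [simMoves, hl] at hm
        exact ruleMoves_lt x hl hm
    · rw [linAut_verState] at hm
      simp only [List.mem_cons, List.not_mem_nil, or_false] at hm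
      rcases hm with rfl | rfl
      · exact (simState_lt_verState q a).trans hi
      · exact special_lt_numStates x (by omega)

/-- The state that is entered when no move is performed. -/
def sink (i : ℕ) : ℕ := cond (linAut x i).1 0 1

theorem superopCode_lt {i : ℕ} (hi : i < numStates x) {o : List (List (ℤ × ℕ)) × ℕ}
    (ho : o ∈ superopCode (sink x i) (linAut x i).2) : o.2 < numStates x := by
  have hsink : sink x i < numStates x := by
    unfold sink; cases (linAut x i).1 <;> exact special_lt_numStates x (by simp)
  simp only [superopCode, List.mem_append, List.mem_map, List.mem_flatMap, List.mem_cons,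
    List.not_mem_nil, or_false] at ho
  rcases ho with ⟨m, hm, rfl⟩ | ⟨m, hm, rfl | rfl | rfl⟩ | ⟨m, hm, rfl⟩
  · exact linAut_moves_lt x hi hm
  all_goals exact hsink

theorem numS_mapAmp : (mapAmp e (aqfaCode x)).numS = numStates x := by
  simp [AQFACode.numS, mapAmp, aqfaCode]

theorem get_mapAmp (s : Fin (mapAmp e (aqfaCode x)).numS) :
    (mapAmp e (aqfaCode x)).1.get s = ((linAut x s).1, decide ((s : ℕ) = 1),
      mapSuperop e (superopCode (sink x s) (linAut x s).2),
      mapSuperop e (superopCode (sink x s) (linAut x s).2)) := by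
  have h : (mapAmp e (aqfaCode x)).1 = (List.range (numStates x)).map fun i =>
      ((linAut x i).1, decide (i = 1), mapSuperop e (superopCode (sink x i) (linAut x i).2),
        mapSuperop e (superopCode (sink x i) (linAut x i).2)) := by
    simp [mapAmp, aqfaCode, stateCode, sink]
  rw [List.get_eq_getElem]
  exact (List.getElem_of_eq h s.2).trans (by simp)

theorem superop_mapAmp (s : Fin (mapAmp e (aqfaCode x)).numS) (σ : Option Unit) :
    (mapAmp e (aqfaCode x)).superop s σ =
      mapSuperop e (superopCode (sink x s) (linAut x s).2) := by
  rcases σ with - | ⟨⟩ <;> simp only [AQFACode.superop, get_mapAmp]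

theorem sum_get {α M : Type} [AddCommMonoid M] (l : List α) (F : α → M) :
    ∑ τ : Fin l.length, F (l.get τ) = (l.map F).sum := by
  simp [Fin.sum_univ_fun_getElem]

theorem mapAmp_aqfaCode_valid (he : ∀ p, val (e p) = ratVal p) :
    (mapAmp e (aqfaCode x)).Valid val where
  start_lt := by rw [numS_mapAmp]; exact special_lt_numStates x (by simp [mapAmp, aqfaCode])
  qstart_lt := show 0 < 4 by norm_num
  next_lt s σ τ := by
    have hs : (s : ℕ) < numStates x := numS_mapAmp x (e := e) ▸ s.2
    have h : ∀ y ∈ (mapAmp e (aqfaCode x)).superop s σ, y.2 < (mapAmp e (aqfaCode x)).numS := by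
      intro y hy
      rw [superop_mapAmp, mapSuperop, List.mem_map] at hy
      obtain ⟨o, ho, rfl⟩ := hy
      rw [numS_mapAmp]
      exact superopCode_lt x hs ho
    exact h _ (List.get_mem _ τ)
  complete s σ := by
    refine (sum_get ((mapAmp e (aqfaCode x)).superop s σ)
      (fun o => (toMatrix val 4 o.1).conjTranspose * toMatrix val 4 o.1)).trans ?_
    rw [superop_mapAmp, mapSuperop, List.map_map]
    simp only [Function.comp_def, toMatrix_map he]
    exact sum_gram_superopCode _ _

end TMCode

/-! ### The computation tree of the AQFA -/

theorem pos_of_sq_pos {r : ℝ} (hr : 0 ≤ r) (h : 0 < r ^ 2) : 0 < r :=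
  hr.lt_of_ne' fun h0 => by simp [h0] at h

namespace AQFA

variable {α : Type} (A : AQFA α)

theorem value_nil_iff (s : A.S) (ψ : EuclideanSpace ℂ A.Q) :
    A.value [] s ψ ↔ s ∈ A.accepting := by
  rw [value]

theorem value_cons_iff (σ : Option α) (l : List (Option α)) (s : A.S)
    (ψ : EuclideanSpace ℂ A.Q) : A.value (σ :: l) s ψ ↔
      (s ∈ A.existential →
        ∃ τ, 0 < A.prob s σ τ ψ ∧ A.value l (A.next s σ τ) (A.post s σ τ ψ)) ∧
      (s ∉ A.existential →
        ∀ τ, 0 < A.prob s σ τ ψ → A.value l (A.next s σ τ) (A.post s σ τ ψ)) := by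
  rw [value]

end AQFA

namespace AQFACode

variable {K : Type} {val : K → ℂ}

/-- The image of a quantum state under the operation element with the given rows. -/
noncomputable def applyRows (val : K → ℂ) (d : ℕ) (rows : List (List K))
    (ψ : EuclideanSpace ℂ (Fin d)) : EuclideanSpace ℂ (Fin d) :=
  WithLp.toLp 2 ((toMatrix val d rows).mulVec ψ.ofLp)

/-- Positive probability means a nonzero image, and quantifying over outcome indices amounts to
quantifying over list entries, since equal entries give equal children. -/
theorem value_cons_iff (c : AQFACode K) (h : c.Valid val) (σ : Option Unit)
    (rest : List (Option Unit)) (s : Fin c.numS) (ψ : EuclideanSpace ℂ (Fin c.dim)) :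
    (c.toAQFA val h).value (σ :: rest) s ψ ↔
      ((c.1.get s).1 = true → ∃ o ∈ c.superop s σ, ∃ ho : o.2 < c.numS,
        applyRows val c.dim o.1 ψ ≠ 0 ∧ (c.toAQFA val h).value rest ⟨o.2, ho⟩
          (((‖applyRows val c.dim o.1 ψ‖⁻¹ : ℝ) : ℂ) • applyRows val c.dim o.1 ψ)) ∧
      ((c.1.get s).1 = false → ∀ o ∈ c.superop s σ, ∀ ho : o.2 < c.numS,
        applyRows val c.dim o.1 ψ ≠ 0 → (c.toAQFA val h).value rest ⟨o.2, ho⟩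
          (((‖applyRows val c.dim o.1 ψ‖⁻¹ : ℝ) : ℂ) • applyRows val c.dim o.1 ψ)) := by
  have hp : ∀ τ : Fin (c.superop s σ).length, 0 < (c.toAQFA val h).prob s σ τ ψ ↔
      applyRows val c.dim ((c.superop s σ).get τ).1 ψ ≠ 0 := fun τ => by
    rw [← norm_pos_iff]
    exact ⟨fun h => pos_of_sq_pos (norm_nonneg _) h, fun h => pow_pos h 2⟩
  have hex : (s ∈ (c.toAQFA val h).existential) ↔ (c.1.get s).1 = true := Iff.rfl
  refine (AQFA.value_cons_iff (c.toAQFA val h) σ rest s ψ).trans ?_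
  refine and_congr (imp_congr hex ?_) (imp_congr ((not_congr hex).trans (Bool.not_eq_true _ ▸ Iff.rfl)) ?_)
  · constructor
    · rintro ⟨τ, h1, h2⟩
      exact ⟨_, List.get_mem _ τ, h.next_lt s σ τ, (hp τ).1 h1, h2⟩
    · rintro ⟨o, ho, hlt, h1, h2⟩
      obtain ⟨τ, rfl⟩ := List.mem_iff_get.1 ho
      exact ⟨τ, (hp τ).2 h1, h2⟩
  · constructor
    · intro H o ho hlt h1
      obtain ⟨τ, rfl⟩ := List.mem_iff_get.1 ho
      exact H τ ((hp τ).2 h1)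
    · intro H τ h1
      exact H _ (List.get_mem _ τ) (h.next_lt s σ τ) ((hp τ).1 h1)

end AQFACode

/-! ### Integer vectors as quantum states -/

/-- An integer vector as an (unnormalized) quantum state. -/
noncomputable def Vec3.toState (v : Vec3) : EuclideanSpace ℂ (Fin 4) :=
  WithLp.toLp 2 ![(v.1 : ℂ), (v.2.1 : ℂ), (v.2.2 : ℂ), 0]

theorem Vec3.toState_eq_zero_iff (v : Vec3) : v.toState = 0 ↔ v = 0 := by
  constructor
  · intro h
    have h0 := congrArg (fun ψ : EuclideanSpace ℂ (Fin 4) => ψ 0) h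
    have h1 := congrArg (fun ψ : EuclideanSpace ℂ (Fin 4) => ψ 1) h
    have h2 := congrArg (fun ψ : EuclideanSpace ℂ (Fin 4) => ψ 2) h
    simp only [toState, PiLp.zero_apply] at h0 h1 h2
    exact Prod.ext (by simpa using h0) (Prod.ext (by simpa using h1) (by simpa using h2))
  · rintro rfl
    ext i
    fin_cases i <;> simp [toState]

/-- The outcome with quaternion unit `0` acts as the matrix itself and keeps the fourth coordinate
zero; the other outcomes need no description because they all enter the sink. -/
theorem applyRows_opCode (S : ℕ) (m : Mat3) (c : ℂ) (v : Vec3) :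
    applyRows ratVal 4 (m.opCode S 0) (c • v.toState) =
      (((S : ℂ) + 1)⁻¹ * c) • Vec3.toState (m.app v) := by
  have h := Mat3.toMatrix_opCode S m 0
  simp only [Fin.isValue, Fin.coe_ofNat_eq_mod, Nat.zero_mod] at h
  rw [applyRows, h]
  ext i
  fin_cases i <;>
    simp [Vec3.toState, Mat3.app, Mat3.dot, Mat3.quat, Matrix.mulVec, dotProduct,
      Fin.sum_univ_four] <;> ring

namespace TMCode

variable (x : TMCode × List ℕ) {K : Type} {val : K → ℂ} {e : ℤ × ℕ → K}

theorem mem_accepting_iff (h : (mapAmp e (aqfaCode x)).Valid val)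
    (s : Fin (mapAmp e (aqfaCode x)).numS) :
    s ∈ ((mapAmp e (aqfaCode x)).toAQFA val h).accepting ↔ (s : ℕ) = 1 := by
  have h1 : s ∈ ((mapAmp e (aqfaCode x)).toAQFA val h).accepting ↔
    ((mapAmp e (aqfaCode x)).1.get s).2.1 = true := Iff.rfl
  rw [h1, get_mapAmp]
  simp

theorem value_aqfa_cons_iff (he : ∀ p, val (e p) = ratVal p)
    (h : (mapAmp e (aqfaCode x)).Valid val) (σ : Option Unit) (rest : List (Option Unit))
    (s : Fin (mapAmp e (aqfaCode x)).numS) (ψ : EuclideanSpace ℂ (Fin 4)) :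
    ((mapAmp e (aqfaCode x)).toAQFA val h).value (σ :: rest) s ψ ↔
      ((linAut x s).1 = true → ∃ o ∈ superopCode (sink x s) (linAut x s).2,
        ∃ ho : o.2 < (mapAmp e (aqfaCode x)).numS,
        applyRows ratVal 4 o.1 ψ ≠ 0 ∧ ((mapAmp e (aqfaCode x)).toAQFA val h).value rest ⟨o.2, ho⟩
          (((‖applyRows ratVal 4 o.1 ψ‖⁻¹ : ℝ) : ℂ) • applyRows ratVal 4 o.1 ψ)) ∧
      ((linAut x s).1 = false → ∀ o ∈ superopCode (sink x s) (linAut x s).2,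
        ∀ ho : o.2 < (mapAmp e (aqfaCode x)).numS,
        applyRows ratVal 4 o.1 ψ ≠ 0 → ((mapAmp e (aqfaCode x)).toAQFA val h).value rest ⟨o.2, ho⟩
          (((‖applyRows ratVal 4 o.1 ψ‖⁻¹ : ℝ) : ℂ) • applyRows ratVal 4 o.1 ψ)) := by
  have hrows : ∀ rows, applyRows val 4 (rows.map (List.map e)) = applyRows ratVal 4 rows := by
    intro rows; funext ψ; rw [applyRows, toMatrix_map he]; rfl
  refine (value_cons_iff (mapAmp e (aqfaCode x)) h σ rest s ψ).trans ?_
  rw [superop_mapAmp, get_mapAmp]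
  refine and_congr (imp_congr Iff.rfl ?_) (imp_congr Iff.rfl ?_)
  · constructor
    · rintro ⟨o, ho, hlt, h1⟩
      obtain ⟨o, ho', rfl⟩ := List.mem_map.1 ho
      exact ⟨o, ho', hlt, hrows o.1 ▸ h1⟩
    · rintro ⟨o, ho, hlt, h1⟩
      exact ⟨_, List.mem_map.2 ⟨o, ho, rfl⟩, hlt, (hrows o.1).symm ▸ h1⟩
  · constructor
    · intro H o ho hlt h1
      have := H _ (List.mem_map.2 ⟨o, ho, rfl⟩) hlt
      exact (hrows o.1 ▸ this) h1
    · intro H o ho hlt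
      obtain ⟨o, ho', rfl⟩ := List.mem_map.1 ho
      have := H o ho' hlt
      exact ((hrows o.1).symm ▸ this)

theorem mem_superopCode_cases {sink : ℕ} {moves : List (Mat3 × ℕ)}
    {o : List (List (ℤ × ℕ)) × ℕ} (ho : o ∈ superopCode sink moves) :
    (∃ m ∈ moves, o = (m.1.opCode (totalSq moves) 0, m.2)) ∨ o.2 = sink := by
  simp only [superopCode, List.mem_append, List.mem_map, List.mem_flatMap, List.mem_cons,
    List.not_mem_nil, or_false] at ho
  rcases ho with ⟨m, hm, rfl⟩ | ⟨m, -, rfl | rfl | rfl⟩ | ⟨m, -, rfl⟩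
  · exact Or.inl ⟨m, hm, rfl⟩
  all_goals exact Or.inr rfl

theorem mem_superopCode_of_mem {sink : ℕ} {moves : List (Mat3 × ℕ)} {m : Mat3 × ℕ}
    (hm : m ∈ moves) : (m.1.opCode (totalSq moves) 0, m.2) ∈ superopCode sink moves :=
  List.mem_append_left _ (List.mem_map.2 ⟨m, hm, rfl⟩)

/-- State `0` is existential and has no moves, so all its outcomes return to its sink, again `0`.
The next lemma is the dual for the universal state `1`. -/
theorem not_value_aqfa_reject (he : ∀ p, val (e p) = ratVal p)
    (h : (mapAmp e (aqfaCode x)).Valid val) : ∀ (l : List (Option Unit))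
    (s : Fin (mapAmp e (aqfaCode x)).numS) (_ : (s : ℕ) = 0) (ψ : EuclideanSpace ℂ (Fin 4)),
    ¬ ((mapAmp e (aqfaCode x)).toAQFA val h).value l s ψ
  | [], s, hs, ψ => by
    refine fun hv => ?_
    have := (mem_accepting_iff x h s).1 ((AQFA.value_nil_iff ((mapAmp e (aqfaCode x)).toAQFA val h) s ψ).1 hv)
    omega
  | σ :: l, s, hs, ψ => by
    rw [value_aqfa_cons_iff x he]
    rintro ⟨H, -⟩
    obtain ⟨o, ho, hlt, -, hv⟩ := H (by simp [hs, linAut, specials])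
    rcases mem_superopCode_cases ho with ⟨m, hm, -⟩ | ho
    · simp [hs, linAut, specials] at hm
    · exact not_value_aqfa_reject he h l _ (by simp [ho, sink, hs, linAut, specials]) _ hv

theorem value_aqfa_accept (he : ∀ p, val (e p) = ratVal p)
    (h : (mapAmp e (aqfaCode x)).Valid val) : ∀ (l : List (Option Unit))
    (s : Fin (mapAmp e (aqfaCode x)).numS) (_ : (s : ℕ) = 1) (ψ : EuclideanSpace ℂ (Fin 4)),
    ((mapAmp e (aqfaCode x)).toAQFA val h).value l s ψ
  | [], s, hs, ψ => by
    exact (AQFA.value_nil_iff ((mapAmp e (aqfaCode x)).toAQFA val h) s ψ).2 ((mem_accepting_iff x h s).2 hs)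
  | σ :: l, s, hs, ψ => by
    rw [value_aqfa_cons_iff x he]
    refine ⟨fun H => by simp [hs, linAut, specials] at H, fun _ o ho hlt _ => ?_⟩
    rcases mem_superopCode_cases ho with ⟨m, hm, -⟩ | ho
    · simp [hs, linAut, specials] at hm
    · exact value_aqfa_accept he h l _ (by simp [ho, sink, hs, linAut, specials]) _

/-- The scalar `c` absorbs both the factor `1 / (S + 1)` and the normalization, neither of which can
make a branch vanish. Sink children are neutral: a rejecting one is never a witness for an
existential node, an accepting one never refutes a universal node. -/
theorem value_aqfa_iff (he : ∀ p, val (e p) = ratVal p)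
    (h : (mapAmp e (aqfaCode x)).Valid val) : ∀ (l : List (Option Unit))
    (s : Fin (mapAmp e (aqfaCode x)).numS) (v : Vec3) (c : ℂ) (_ : c ≠ 0),
    ((mapAmp e (aqfaCode x)).toAQFA val h).value l s (c • v.toState) ↔
      (linAut x).value l.length s v
  | [], s, v, c, hc => by
    exact (AQFA.value_nil_iff ((mapAmp e (aqfaCode x)).toAQFA val h) s _).trans (mem_accepting_iff x h s)
  | σ :: l, s, v, c, hc => by
    have hs : (s : ℕ) < numStates x := numS_mapAmp x (e := e) ▸ s.2
    have hS : ((totalSq (linAut x s).2 : ℂ) + 1)⁻¹ * c ≠ 0 :=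
      mul_ne_zero (inv_ne_zero (Nat.cast_add_one_ne_zero _)) hc
    have hz : ∀ m : Mat3, applyRows ratVal 4 (m.opCode (totalSq (linAut x s).2) 0)
        (c • v.toState) ≠ 0 ↔ m.app v ≠ 0 := fun m => by
      rw [applyRows_opCode, smul_ne_zero_iff_right hS, ne_eq, Vec3.toState_eq_zero_iff]
    have ih : ∀ (m : Mat3 × ℕ) (hm : m.2 < (mapAmp e (aqfaCode x)).numS), m.1.app v ≠ 0 →
        (((mapAmp e (aqfaCode x)).toAQFA val h).value l ⟨m.2, hm⟩
          (((‖applyRows ratVal 4 (m.1.opCode (totalSq (linAut x s).2) 0)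
            (c • v.toState)‖⁻¹ : ℝ) : ℂ) •
            applyRows ratVal 4 (m.1.opCode (totalSq (linAut x s).2) 0) (c • v.toState)) ↔
          (linAut x).value l.length m.2 (m.1.app v)) := fun m hm h0 => by
      have hn := norm_ne_zero_iff.2 ((hz m.1).2 h0)
      rw [applyRows_opCode] at hn ⊢
      rw [smul_smul]
      exact value_aqfa_iff he h l ⟨m.2, hm⟩ _ _
        (mul_ne_zero (Complex.ofReal_ne_zero.2 (inv_ne_zero hn)) hS)
    rw [value_aqfa_cons_iff x he, List.length_cons, LinAut.value]
    refine and_congr (imp_congr_right fun hex => ?_) (imp_congr_right fun hex => ?_)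
    · constructor
      · rintro ⟨o, ho, hlt, h0, hv⟩
        rcases mem_superopCode_cases ho with ⟨m, hm, rfl⟩ | ho
        · have h1 := (hz m.1).1 h0
          exact ⟨m, hm, h1, (ih m hlt h1).1 hv⟩
        · exact absurd hv (not_value_aqfa_reject x he h l _ (by simp [ho, sink, hex]) _)
      · rintro ⟨m, hm, h0, hv⟩
        have hlt : m.2 < (mapAmp e (aqfaCode x)).numS := by
          rw [numS_mapAmp]; exact linAut_moves_lt x hs hm
        exact ⟨_, mem_superopCode_of_mem hm, hlt, (hz m.1).2 h0, (ih m hlt h0).2 hv⟩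
    · constructor
      · intro H m hm h0
        have hlt : m.2 < (mapAmp e (aqfaCode x)).numS := by
          rw [numS_mapAmp]; exact linAut_moves_lt x hs hm
        exact (ih m hlt h0).1 (H _ (mem_superopCode_of_mem hm) hlt ((hz m.1).2 h0))
      · intro H o ho hlt h0
        rcases mem_superopCode_cases ho with ⟨m, hm, rfl⟩ | ho
        · have h1 := (hz m.1).1 h0
          exact (ih m hlt h1).2 (H m hm h1)
        · exact value_aqfa_accept x he h l _ (by simp [ho, sink, hex]) _

theorem accepts_iff (he : ∀ p, val (e p) = ratVal p) (h : (mapAmp e (aqfaCode x)).Valid val)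
    (w : List Unit) : w ∈ ((mapAmp e (aqfaCode x)).toAQFA val h).language ↔
      (linAut x).value (2 * w.length + 4) 4 (1, 0, 0) := by
  -- The letters and the two end-markers, with two steps on each.
  have hlen : (AQFA.schedule w).length = 2 * w.length + 4 := by
    simp [AQFA.schedule, List.length_flatMap, Function.comp_def]; omega
  have hstart : (EuclideanSpace.single (0 : Fin 4) (1 : ℂ)) =
      (1 : ℂ) • Vec3.toState (1, 0, 0) := by
    ext i
    fin_cases i <;> simp [Vec3.toState]
  rw [← hlen, ← value_aqfa_iff x he h (AQFA.schedule w)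
    ⟨4, numS_mapAmp x (e := e) ▸ special_lt_numStates x (by norm_num)⟩ (1, 0, 0) 1 one_ne_zero,
    ← hstart]
  rfl

theorem language_nonempty_iff (he : ∀ p, val (e p) = ratVal p)
    (h : (mapAmp e (aqfaCode x)).Valid val) :
    ((mapAmp e (aqfaCode x)).toAQFA val h).language.Nonempty ↔ x.1.Halts x.2 := by
  constructor
  · rintro ⟨w, hw⟩
    exact halts_of_value_start x ((accepts_iff x he h w).1 hw)
  · intro hx
    obtain ⟨k, hk⟩ := value_start_of_halts x hx
    exact ⟨List.replicate k (), (accepts_iff x he h _).2 (hk _ (by simp; omega))⟩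

theorem exists_replicate_mem_language (he : ∀ p, val (e p) = ratVal p)
    (h : (mapAmp e (aqfaCode x)).Valid val) (hx : x.1.Halts x.2) :
    ∃ N, ∀ n ≥ N, List.replicate n () ∈ ((mapAmp e (aqfaCode x)).toAQFA val h).language := by
  obtain ⟨k, hk⟩ := value_start_of_halts x hx
  exact ⟨k, fun n hn => (accepts_iff x he h _).2 (hk _ (by simp; omega))⟩

end TMCode

/-! ### A Turing machine with an undecidable halting problem -/

/-- A transposition moves the image of the chosen point to `0`, the number reserved for both the
blank and the initial state. -/
theorem exists_injective_nat_eq_zero {α : Type*} [Countable α] (a : α) :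
    ∃ f : α → ℕ, Function.Injective f ∧ f a = 0 := by
  obtain ⟨f, hf⟩ := exists_injective_nat α
  exact ⟨fun b => Equiv.swap (f a) 0 (f b), (Equiv.injective _).comp hf,
    Equiv.swap_apply_left _ _⟩

theorem exists_injOn_nat_eq_zero {α : Type*} (S : Finset α) {a : α} (ha : a ∈ S) :
    ∃ f : α → ℕ, Set.InjOn f S ∧ f a = 0 := by
  classical
  obtain ⟨f, hf, h0⟩ := exists_injective_nat_eq_zero (⟨a, ha⟩ : S)
  refine ⟨fun b => if h : b ∈ S then f ⟨b, h⟩ else 0, fun b hb c hc h => ?_, by simpa [ha] using h0⟩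
  have hb' : b ∈ S := hb
  have hc' : c ∈ S := hc
  simp only [hb', hc', dif_pos] at h
  simpa using hf h

/-- If the entries at a key form the graph of an option, the order and repetition of the rules do
not matter. -/
theorem lookup_eq_of_mem_iff {α β : Type} [BEq α] [LawfulBEq α] {l : List (α × β)} {a : α}
    {o : Option β} (h : ∀ b, (a, b) ∈ l ↔ o = some b) : l.lookup a = o := by
  rcases hl : l.lookup a with - | b
  · rcases o with - | b
    · rfl
    · have := List.lookup_eq_none_iff.1 hl (a, b) ((h b).2 rfl)
      simp at this
  · exact ((h b).1 (TMCode.mem_of_lookup hl)).symm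

open Turing

namespace TMCode

/-- The action of a rule, with the symbols renamed. -/
def actionCode {Γ : Type*} (f : Γ → ℕ) : TM0.Stmt Γ → Bool ⊕ ℕ
  | TM0.Stmt.move Dir.left => Sum.inl true
  | TM0.Stmt.move Dir.right => Sum.inl false
  | TM0.Stmt.write a => Sum.inr (f a)

theorem exists_lookup_eq {Γ Λ : Type*} [Inhabited Λ] [Finite Γ] (M : TM0.Machine Γ Λ)
    (S : Finset Λ) {f : Γ → ℕ} (hf : Function.Injective f) {g : Λ → ℕ} (hg : Set.InjOn g S) :
    ∃ T : TMCode, ∀ q ∈ S, ∀ a, T.lookup (g q, f a) =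
      (M q a).map fun r => (g r.1, actionCode f r.2) := by
  classical
  have := Fintype.ofFinite Γ
  refine ⟨(S.toList.product (Finset.univ : Finset Γ).toList).filterMap fun p =>
    (M p.1 p.2).map fun r => ((g p.1, f p.2), (g r.1, actionCode f r.2)), fun q hq a =>
    lookup_eq_of_mem_iff fun b => ?_⟩
  simp only [List.mem_filterMap, Option.map_eq_some_iff, Prod.exists, List.pair_mem_product,
    Finset.mem_toList, Finset.mem_univ, and_true, Prod.mk.injEq]
  constructor
  · rintro ⟨q', a', hq', q₁, s, hM, ⟨h1, h2⟩, h3⟩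
    obtain rfl := hg hq' hq h1
    obtain rfl := hf h2
    exact ⟨q₁, s, hM, h3⟩
  · rintro ⟨q₁, s, hM, h⟩
    exact ⟨q, a, hq, q₁, s, hM, ⟨rfl, rfl⟩, h⟩

/-- Renaming states and symbols commutes with steps from states in the support `S`. Steps stay in
`S`, so injectivity of the state names on `S` suffices. -/
theorem exists_halts_iff_eval_dom {Γ Λ : Type*} [Inhabited Γ] [Inhabited Λ] [Finite Γ]
    (M : TM0.Machine Γ Λ) (S : Finset Λ) (hS : TM0.Supports M S) :
    ∃ (T : TMCode) (f : Γ → ℕ), ∀ l, T.Halts (l.map f) ↔ (TM0.eval M l).Dom := by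
  obtain ⟨f, hf, hf0⟩ := exists_injective_nat_eq_zero (default : Γ)
  obtain ⟨g, hg, hg0⟩ := exists_injOn_nat_eq_zero S (show default ∈ S from hS.1)
  obtain ⟨T, hT⟩ := exists_lookup_eq M S hf hg
  let F : PointedMap Γ ℕ := ⟨f, hf0⟩
  let G : PointedMap Λ ℕ := ⟨g, hg0⟩
  have hstep : ∀ c : TM0.Cfg Γ Λ, c.q ∈ S → TM0.step T.toMachine (TM0.Cfg.map F G c) =
      (TM0.step M c).map (TM0.Cfg.map F G) := by
    rintro ⟨q, t⟩ hq
    have h1 : T.toMachine (g q) (f t.head) = (M q t.head).map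
        (Prod.map g (TM0.Stmt.map F)) := by
      rw [toMachine, hT q hq, Option.map_map]
      congr 1
      funext ⟨q', s⟩
      rcases s with (_ | _) | a <;> rfl
    have h2 : T.toMachine (G q) (t.map F).head = (M q t.head).map
        (Prod.map g (TM0.Stmt.map F)) := by
      rw [← h1, Tape.map_fst]
    unfold TM0.step TM0.Cfg.map
    simp only [h2]
    rcases M q t.head with (_ | ⟨q', d | a⟩)
    · rfl
    · simp only [Option.map_some, Tape.map_move F]
      rfl
    · simp only [Option.map_some, Tape.map_write]
      rfl
  have hresp : StateTransition.Respects (TM0.step M) (TM0.step T.toMachine)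
      fun a b => a.q ∈ S ∧ TM0.Cfg.map F G a = b := by
    intro c _ ⟨cs, rfl⟩
    cases e : TM0.step M c
    · rw [hstep c cs, e]; rfl
    · refine ⟨_, ⟨TM0.step_supports M hS e cs, rfl⟩, Relation.TransGen.single ?_⟩
      rw [hstep c cs, e]; rfl
  refine ⟨T, f, fun l => ?_⟩
  have hinit : TM0.Cfg.map F G (TM0.init l) = TM0.init (l.map f) := TM0.map_init F G l
  exact StateTransition.tr_eval_dom hresp ⟨hS.1, hinit⟩

instance finite_stackIndex : Finite PartrecToTM2.K' := by
  refine Finite.of_injective (fun k : PartrecToTM2.K' => match k with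
    | .main => (0 : Fin 4) | .rev => 1 | .aux => 2 | .stack => 3) fun a b h => ?_
  cases a <;> cases b <;> simp_all

theorem exists_halts_iff_code_eval_dom (c : ToPartrec.Code) :
    ∃ (T : TMCode) (f : TM2to1.Γ' PartrecToTM2.K' (fun _ => PartrecToTM2.Γ') → ℕ),
      ∀ v, T.Halts ((TM2to1.trInit PartrecToTM2.K'.main (PartrecToTM2.trList v)).map f) ↔
        (c.eval v).Dom := by
  -- The default label is the initial one, so this choice makes the machine start on the code `c`.
  let hΛ : Inhabited PartrecToTM2.Λ' := ⟨PartrecToTM2.trNormal c .halt⟩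
  have : Finite (TM2to1.Γ' PartrecToTM2.K' (fun _ => PartrecToTM2.Γ')) :=
    inferInstanceAs (Finite (Bool × (PartrecToTM2.K' → Option PartrecToTM2.Γ')))
  have h2 := PartrecToTM2.tr_supports c .halt
  have h1 := TM2to1.tr_supports (M := PartrecToTM2.tr) h2
  have h0 := TM1to0.tr_supports _ h1
  obtain ⟨T, f, hT⟩ := exists_halts_iff_eval_dom _ _ h0
  refine ⟨T, f, fun v => (hT _).trans ?_⟩
  rw [TM1to0.tr_eval]
  refine (TM2to1.tr_eval_dom (M := PartrecToTM2.tr) _ _).trans ?_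
  have hinit : TM2.init PartrecToTM2.K'.main (PartrecToTM2.trList v) =
      PartrecToTM2.init c v := by
    unfold TM2.init PartrecToTM2.init
    congr 1
    funext k
    cases k <;> rfl
  show (StateTransition.eval (TM2.step PartrecToTM2.tr) _).Dom ↔ _
  rw [hinit, PartrecToTM2.tr_eval]
  rfl

end TMCode

/-! ### Computable inputs for a fixed machine -/

/-- The binary digits of a number, the least significant one first. -/
def binaryDigits : ℕ → List Bool
  | 0 => []
  | n + 1 => decide ((n + 1) % 2 = 1) :: binaryDigits ((n + 1) / 2)
  decreasing_by omega

theorem primrec_binaryDigits : Primrec binaryDigits := by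
  have hlen : Primrec fun p : Unit × List (List Bool) => p.2.length :=
    Primrec.list_length.comp Primrec.snd
  have hcons : Primrec fun q : (Unit × List (List Bool)) × List Bool =>
      decide (q.1.2.length % 2 = 1) :: q.2 :=
    Primrec.list_cons.comp (Primrec.eq.decide.comp
      (Primrec.nat_mod.comp (hlen.comp Primrec.fst) (Primrec.const 2)) (Primrec.const 1))
      Primrec.snd
  -- Course-of-values recursion: the table of earlier values has length `n`, and its entry at `n /
  -- 2` holds the remaining digits.
  have hrec : Primrec fun p : Unit × List (List Bool) =>
      (p.2[p.2.length / 2]?).map fun l => decide (p.2.length % 2 = 1) :: l :=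
    Primrec.option_map (Primrec.list_getElem?.comp Primrec.snd
      (Primrec.nat_div.comp hlen (Primrec.const 2))) hcons.to₂
  have hg : Primrec₂ fun (_ : Unit) (l : List (List Bool)) => if l.length = 0 then some []
      else (l[l.length / 2]?).map fun t => decide (l.length % 2 = 1) :: t :=
    Primrec.ite (Primrec.eq.comp hlen (Primrec.const 0)) (Primrec.const _) hrec
  refine (Primrec.nat_strong_rec (fun _ : Unit => binaryDigits) hg fun _ n => ?_).comp
    (Primrec.const ()) Primrec.id
  rcases n with - | n
  · simp [binaryDigits]
  · have h : (n + 1) / 2 < n + 1 := by omega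
    simp [binaryDigits, List.getElem?_range h]

theorem PosNum.trPosNum_eq (p : PosNum) : PartrecToTM2.trPosNum p =
    (binaryDigits (p : ℕ)).map fun b => cond b PartrecToTM2.Γ'.bit1 PartrecToTM2.Γ'.bit0 := by
  have key : ∀ n : ℕ, 0 < n → binaryDigits n = decide (n % 2 = 1) :: binaryDigits (n / 2) := by
    intro n hn
    obtain ⟨n, rfl⟩ : ∃ m, n = m + 1 := ⟨n - 1, by omega⟩
    rw [binaryDigits]
  induction p with
  | one =>
    have h : binaryDigits 1 = [true] := by rw [key 1 one_pos]; simp [binaryDigits]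
    simp [PartrecToTM2.trPosNum, h]
  | bit1 p ih =>
    rw [PartrecToTM2.trPosNum, key _ (PosNum.cast_pos _), PosNum.cast_bit1, ih]
    have h1 : ((p : ℕ) + p + 1) % 2 = 1 := by omega
    have h2 : ((p : ℕ) + p + 1) / 2 = p := by omega
    simp [h1, h2]
  | bit0 p ih =>
    rw [PartrecToTM2.trPosNum, key _ (PosNum.cast_pos _), PosNum.cast_bit0, ih]
    have h1 : ((p : ℕ) + p) % 2 = 0 := by omega
    have h2 : ((p : ℕ) + p) / 2 = p := by omega
    simp [h1, h2]

theorem trNat_eq_binaryDigits (n : ℕ) : PartrecToTM2.trNat n =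
    (binaryDigits n).map fun b => cond b PartrecToTM2.Γ'.bit1 PartrecToTM2.Γ'.bit0 := by
  have h : ((n : Num) : ℕ) = n := Num.to_of_nat n
  rw [PartrecToTM2.trNat]
  rcases hn : (n : Num) with - | p
  · rw [hn] at h
    have : n = 0 := by simpa using h.symm
    subst this
    simp [PartrecToTM2.trNum, binaryDigits]
  · rw [hn] at h
    rw [← h]
    exact PosNum.trPosNum_eq p

namespace TMCode

/-- The machine is fixed by `f`; only the input depends on `n`. It is the tape coding of the stack
`[n]`, that is, the binary digits in reverse after a cell `z` that carries the bottom marker and the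
separator. -/
theorem exists_halts_iff_partrec_dom {f : ℕ →. ℕ} (hf : Partrec f) :
    ∃ (T : TMCode) (w : ℕ → List ℕ), Computable w ∧ ∀ n, T.Halts (w n) ↔ (f n).Dom := by
  obtain ⟨c, hc⟩ := ToPartrec.Code.exists_code (Nat.Partrec'.part_iff₁.2 hf)
  obtain ⟨T, g, hT⟩ := exists_halts_iff_code_eval_dom c
  let F : PartrecToTM2.Γ' → ℕ := fun a =>
    g (false, Function.update (fun _ => none) PartrecToTM2.K'.main (some a))
  let z : ℕ := g (true, Function.update (fun _ => none) PartrecToTM2.K'.main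
    (some PartrecToTM2.Γ'.cons))
  refine ⟨T, fun n => z :: (binaryDigits n).reverse.map fun b =>
    F (cond b PartrecToTM2.Γ'.bit1 PartrecToTM2.Γ'.bit0), ?_, fun n => ?_⟩
  · have hF : Primrec₂ fun (_ : ℕ) (b : Bool) =>
        F (cond b PartrecToTM2.Γ'.bit1 PartrecToTM2.Γ'.bit0) :=
      ((Primrec.dom_bool fun b => F (cond b PartrecToTM2.Γ'.bit1 PartrecToTM2.Γ'.bit0)).comp
        Primrec.snd).to₂
    exact (Primrec.list_cons.comp (Primrec.const z) (Primrec.list_map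
      (Primrec.list_reverse.comp primrec_binaryDigits) hF)).to_comp
  · have hw : z :: ((binaryDigits n).reverse.map fun b =>
        F (cond b PartrecToTM2.Γ'.bit1 PartrecToTM2.Γ'.bit0)) =
        (TM2to1.trInit PartrecToTM2.K'.main (PartrecToTM2.trList [n])).map g := by
      simp only [TM2to1.trInit, PartrecToTM2.trList, trNat_eq_binaryDigits, List.reverse_append,
        List.reverse_cons, List.reverse_nil, List.nil_append, List.singleton_append,
        ← List.map_reverse]
      change _ = z :: List.map g (List.map _ (List.map _ _))
      refine congrArg (z :: ·) ?_
      induction (binaryDigits n).reverse with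
      | nil => rfl
      | cons b l ih => exact congrArg (_ :: ·) ih
    change T.Halts (z :: _) ↔ _
    rw [hw, hT]
    have h := hc (n ::ᵥ List.Vector.nil)
    have h' : c.eval [n] = pure <$> f n := h
    rw [h']
    rfl

end TMCode

/-! ### Undecidability of emptiness -/

theorem not_decidableProblem_emptiness (K : Type) [Primcodable K] (val : K → ℂ)
    {e : ℤ × ℕ → K} (he : Computable e) (hval : ∀ p, val (e p) = ratVal p) :
    ¬ DecidableProblem (fun (c : AQFACode K) (h : c.Valid val) =>
      (c.toAQFA val h).language = ∅) := by
  classical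
  rintro ⟨d, hd, hcorrect⟩
  -- The universal function: one machine then handles every code as input.
  have hf : Partrec fun n : ℕ => Nat.Partrec.Code.eval (Denumerable.ofNat _ n) 0 :=
    Nat.Partrec.Code.eval_part.comp (Computable.ofNat _) (Computable.const 0)
  obtain ⟨T, w, hw, hT⟩ := TMCode.exists_halts_iff_partrec_dom hf
  refine ComputablePred.halting_problem 0 ⟨inferInstance, ?_⟩
  have hcode : Computable fun c : Nat.Partrec.Code =>
      mapAmp e (TMCode.aqfaCode (T, w (Encodable.encode c))) :=
    (computable_mapAmp he).comp (TMCode.primrec_aqfaCode.to_comp.comp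
      (Computable.pair (Computable.const T) (hw.comp Computable.encode)))
  -- The decider may diverge on malformed descriptions, but those constructed here are all valid.
  -- Its answer is negated because halting means a nonempty language.
  refine ((hd.comp hcode).map (Primrec.not.to_comp.comp Computable.snd).to₂).of_eq fun c => ?_
  have hv := TMCode.mapAmp_aqfaCode_valid (T, w (Encodable.encode c)) hval
  obtain ⟨b, hb, hiff⟩ := hcorrect _ hv
  have hne := TMCode.language_nonempty_iff (T, w (Encodable.encode c)) hval hv
  rw [hT, Denumerable.ofNat_encode, Set.nonempty_iff_ne_empty] at hne
  rw [Part.eq_some_iff.2 hb, Part.map_some]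
  congr 1
  rw [Bool.eq_iff_iff, decide_eq_true_iff]
  change (!b) = true ↔ (c.eval 0).Dom
  rw [← hne, Bool.not_eq_true', ← Bool.not_eq_true, hiff]

theorem mainTheorem3 :
    (∀ (K : Type) [Primcodable K] (val : K → ℂ),
      (∃ e : ℤ × ℕ → K, Computable e ∧ ∀ p, val (e p) = ratVal p) →
      ¬ DecidableProblem (fun (c : AQFACode K) (h : c.Valid val) =>
          (c.toAQFA val h).language = ∅)) ∧
    (∃ R : TMCode × List ℕ → AQFACode (ℤ × ℕ), Computable R ∧
      ∀ (M : TMCode) (w : List ℕ), ∃ h : (R (M, w)).Valid ratVal,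
        (((R (M, w)).toAQFA ratVal h).language.Nonempty ↔ M.Halts w) ∧
        (M.Halts w → ∃ N, ∀ n ≥ N,
          List.replicate n () ∈ ((R (M, w)).toAQFA ratVal h).language)) := by
  refine ⟨fun K _ val ⟨_, he, hval⟩ => not_decidableProblem_emptiness K val he hval,
    fun x => AQFACode.mapAmp id (TMCode.aqfaCode x), ?_, fun M w => ?_⟩
  · exact (AQFACode.computable_mapAmp Computable.id).comp TMCode.primrec_aqfaCode.to_comp
  · exact ⟨TMCode.mapAmp_aqfaCode_valid (M, w) fun _ => rfl,
      TMCode.language_nonempty_iff (M, w) (fun _ => rfl) _,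
      TMCode.exists_replicate_mem_language (M, w) (fun _ => rfl) _⟩
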